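/- **Theorem 1.** Fix an integer $d\ge 2$ and a real $\lambda>0$, and let $\mathbb T_d$ be the infinite rooted $d$-ary tree (every vertex has $d$ children) with one extra vertex $\mathfrak b$ attached to the root. *Chase-escape with death* with rates $\lambda$ and $\rho>0$ is the Markov process in which every vertex is white, red, blue or dead, and in which, independently, an adjacent pair (red, white) becomes (red, red) at rate $\lambda$, an adjacent pair (blue, red) becomes (blue, blue) at rate $1$, and a red vertex becomes dead at rate $\rho$; blue and dead vertices never change. Initially $\mathfrak b$ is blue, the root is red, and all other vertices are white. Let $P_{\lambda,\rho}$ be its law, let $A$ be the event that infinitely many vertices are ever red, and $B$ the event that infinitely many vertices are ever blue. Say that *escape* occurs at $\rho$ if $P_{\lambda,\rho}(A)>0$ and $P_{\lambda,\rho}(B)=0$, and that *extinction* occurs at $\rho$ if $P_{\lambda,\rho}(A)=0$. Put $$\rho_c=\inf\{\rho>0: P_{\lambda,\rho}(B)=0\},\qquad \rho_e=\inf\{\rho>0: P_{\lambda,\rho}(A)=0\},$$ $$\lambda_c^{\pm}=2d-1\pm 2\sqrt{d^2-d},\qquad \Lambda=(\lambda_c^-,\lambda_c^+).$$ (i) If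 $\lambda\in\Lambda$, then $0<\rho_c<\rho_e=\lambda(d-1)$, escape occurs at $\rho=\rho_c$, and extinction occurs at $\rho=\rho_e$. (ii) If $\lambda\notin\Lambda$, then $0=\rho_c<\rho_e=\lambda(d-1)$, and extinction occurs at $\rho=\rho_e$. -/

import Mathlib

open MeasureTheory ProbabilityTheory Set
open scoped ENNReal NNReal

namespace CED

noncomputable section

/-- The four possible states of a site. -/
inductive State
  | white
  | red
  | blue
  | dead

/-- Vertices of the infinite rooted `d`-ary tree: finite words over `Fin d`, the most recent letter
first. The root is `[]`, and the children of `v` are the words `i :: v`. -/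
abbrev Vertex (d : ℕ) : Type := List (Fin d)

/-- All sites: the vertices of the tree, and one extra site `none` attached to the root. The parent
of the vertex `i :: v` is `v`, the parent of the root is the extra site, and the edges of the graph
are the pairs (parent, child). -/
abbrev Site (d : ℕ) : Type := Option (Vertex d)

/-- The waiting times attached to a vertex `v`: along the edge from the parent of `v` to `v`, the time that
red, resp. blue, needs to cross it, and the lifetime of a red particle at `v`. -/
abbrev Clocks (d : ℕ) : Type := Vertex d → ℝ × ℝ × ℝ

def redClock {d : ℕ} (ω : Clocks d) (v : Vertex d) : ℝ≥0∞ := ENNReal.ofReal (ω v).1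

def blueClock {d : ℕ} (ω : Clocks d) (v : Vertex d) : ℝ≥0∞ := ENNReal.ofReal (ω v).2.1

def deathClock {d : ℕ} (ω : Clocks d) (v : Vertex d) : ℝ≥0∞ := ENNReal.ofReal (ω v).2.2

/-- The law `P_{λ,ρ}` of the waiting times: they are independent, with rates `lam` (red crosses an
edge), `1` (blue crosses an edge) and `rho` (a red particle dies). -/
def P (d : ℕ) (lam rho : ℝ) : Measure (Clocks d) :=
  Measure.infinitePi fun _ : Vertex d =>
    (expMeasure lam).prod ((expMeasure 1).prod (expMeasure rho))

/-- The times at which a site becomes red, blue, dead (`∞` if this never happens). -/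
structure Times where
  red : ℝ≥0∞
  blue : ℝ≥0∞
  dead : ℝ≥0∞

/-- The time at which a site stops being red. -/
def Times.leaveRed (T : Times) : ℝ≥0∞ := min T.blue T.dead

/-- The history of a site that turns red at time `r` and whose parent turns blue at time `b`
(either may be `∞`), with blue waiting time `W` and lifetime `D`. The site and its parent are in
states red and blue from time `max r b` on, until the site leaves the state red. Blue therefore
takes the site at time `max r b + W`, unless the site died before, at time `r + D`. -/
def history (r b W D : ℝ≥0∞) : Times where
  red := r
  blue := if max r b + W < r + D then max r b + W else ∞
  dead := if r + D ≤ max r b + W then r + D else ∞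

/-- The history of each vertex, from the waiting times. The root is red and the extra site is blue
at time `0`. A child of a vertex turns red once the red waiting time of the connecting edge has
elapsed since the parent turned red, provided that the parent is then still red.

No vertex other than its parent ever colours a vertex of this tree: the parent of a red or blue vertex is
never white, and the parent of a blue vertex is itself blue, hence never red. Each waiting
time is started at most once, at the moment when the transition it governs becomes possible; by the
lack of memory of the exponential law this is the Markov process with the given transition rates. -/
def times {d : ℕ} (ω : Clocks d) : Vertex d → Times
  | [] => history 0 0 (blueClock ω []) (deathClock ω [])
  | i :: v =>
    history
      (if (times ω v).red + redClock ω (i :: v) < (times ω v).leaveRed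
        then (times ω v).red + redClock ω (i :: v) else ∞)
      (times ω v).blue (blueClock ω (i :: v)) (deathClock ω (i :: v))

/-- The state of a site with the given history at time `t`. -/
def Times.stateAt (T : Times) (t : ℝ≥0) : State :=
  if (t : ℝ≥0∞) < T.red then .white
  else if T.blue ≤ t then .blue
  else if T.dead ≤ t then .dead
  else .red

/-- Chase-escape with death: the state of each site at time `t`. -/
def state {d : ℕ} (ω : Clocks d) (t : ℝ≥0) : Site d → State
  | none => .blue
  | some v => (times ω v).stateAt t

/-- The set of sites that are ever red. -/
def redSites {d : ℕ} (ω : Clocks d) : Set (Site d) := {x | ∃ t, state ω t x = .red}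

/-- The set of sites that are ever blue. -/
def blueSites {d : ℕ} (ω : Clocks d) : Set (Site d) := {x | ∃ t, state ω t x = .blue}

/-- Red occupies infinitely many sites. -/
def eventA (d : ℕ) : Set (Clocks d) := {ω | (redSites ω).Infinite}

/-- Blue occupies infinitely many sites. -/
def eventB (d : ℕ) : Set (Clocks d) := {ω | (blueSites ω).Infinite}

def Escape (d : ℕ) (lam rho : ℝ) : Prop :=
  0 < P d lam rho (eventA d) ∧ P d lam rho (eventB d) = 0

def Extinction (d : ℕ) (lam rho : ℝ) : Prop := P d lam rho (eventA d) = 0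

/-- The critical value `ρ_c`; the death rate ranges over the positive reals. -/
def rhoC (d : ℕ) (lam : ℝ) : ℝ := sInf {rho : ℝ | 0 < rho ∧ P d lam rho (eventB d) = 0}

/-- The critical value `ρ_e`; the death rate ranges over the positive reals. -/
def rhoE (d : ℕ) (lam : ℝ) : ℝ := sInf {rho : ℝ | 0 < rho ∧ P d lam rho (eventA d) = 0}

/-- `λ_c^-` -/
def lamMinus (d : ℕ) : ℝ := 2 * d - 1 - 2 * √((d : ℝ) ^ 2 - d)

/-- `λ_c^+` -/
def lamPlus (d : ℕ) : ℝ := 2 * d - 1 + 2 * √((d : ℝ) ^ 2 - d)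

/-- The interval `Λ`. -/
def Lambda (d : ℕ) : Set ℝ := Ioo (lamMinus d) (lamPlus d)

end

end CED

/-!
# Phase transitions of chase-escape with death on the `d`-ary tree

**Reduction to a branching process with delays.** If a vertex turns red at time `r` and its parent
turns blue at time `r + t`, call `t` its delay. Blue takes the vertex if its clocks satisfy
`t + W < D`; a child with red clock `R` is then reached by red in time if `R < t + W`, and its delay
is `t + W - R`. So the vertices which blue takes form a branching process whose types are the
delays (`BlueAt`, `exists_blue_iff`), and splitting the clocks at the root (`prob_exists_shift`)
gives, for the survival probabilities `reach` of an edge whose parent vertex stays red for a time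
`u`, the recursion `y_(n+1) = genOp (anyOf d y_n)`. Here `anyOf d y = 1 - (1 - y)^d`, and `genOp` is
the composition of two explicit integral operators (`reach_succ`). Blue survives with positive
probability if and only if the limit of the `y_n` is not zero. The linearization of the recursion is
the mean operator `K y = genOp (d y)`.

**Red.** Without blue, red is a branching process with mean offspring `d λ / (λ + ρ)`, and this
dominates red in the presence of blue. It is critical at `ρ = λ (d - 1)`, hence red dies out there
(`prob_eventA_critical`). For smaller `ρ` it is supercritical, and red survives if the root dies
before blue takes it but after having infected a child, because blue never enters the subtree of
that child (`prob_eventA_pos`).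

**Blue dies out** as soon as `K` contracts a positive function. For `ρ` slightly below `λ (d - 1)`
one uses that, along a path taken by blue, each lifetime exceeds both the red clock of the next edge
and the blue clock, which is strictly less likely than exceeding the former alone
(`exists_prob_eventB_eq_zero`); so `ρ_c < ρ_e`. For `λ ∉ Λ`, that is `4 d λ ≤ (1 + λ)^2`, an
exponential function is contracted for every `ρ > 0` (`prob_eventB_eq_zero_of_mul_le`); so
`ρ_c = 0`.

**Blue survives** as soon as `K` enlarges a bounded function by a factor `c > 1`, since a small
multiple of this function is then a lower bound for all `y_n` (`prob_eventB_pos_of_test`). If the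
function has compact support, the same holds for all death rates up to a slightly larger one
(`exists_forall_prob_eventB_pos`). For `λ ∈ Λ` and `ρ = 0`, such a function is the first half period
of an oscillating eigenfunction (`exists_small_prob_eventB_pos`); so `ρ_c > 0`. If blue survives at
some `ρ`, the limit of the `y_n` itself leads to such a function
(`exists_gt_forall_prob_eventB_pos`); so the survival of blue is an open condition on `ρ`, and blue
dies out at `ρ_c`.
-/

namespace CED

/-! ### Splitting the clocks at the root -/

/-- The law of the three clocks of a single vertex. -/
noncomputable def clockLaw (lam rho : ℝ) : Measure (ℝ × ℝ × ℝ) :=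
  (expMeasure lam).prod ((expMeasure 1).prod (expMeasure rho))

lemma isProbabilityMeasure_clockLaw {lam rho : ℝ} (hlam : 0 < lam) (hrho : 0 < rho) :
    IsProbabilityMeasure (clockLaw lam rho) := by
  have := isProbabilityMeasure_expMeasure hlam
  have := isProbabilityMeasure_expMeasure hrho
  have := isProbabilityMeasure_expMeasure one_pos
  unfold clockLaw
  infer_instance

lemma infinitePi_option {ι X : Type*} [MeasurableSpace X] (μ : Measure X)
    [IsProbabilityMeasure μ] :
    (μ.prod (Measure.infinitePi fun _ : ι => μ)).map
        (fun p (o : Option ι) => o.elim p.1 p.2) =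
      Measure.infinitePi fun _ : Option ι => μ := by
  classical
  refine Measure.eq_infinitePi _ fun s t ht => ?_
  have hm : Measurable (fun (p : X × (ι → X)) (o : Option ι) => o.elim p.1 p.2) := by
    refine measurable_pi_lambda _ fun o => ?_
    cases o with
    | none => exact measurable_fst
    | some i => exact (measurable_pi_apply i).comp measurable_snd
  rw [Measure.map_apply hm (.pi s.countable_toSet fun i _ => ht i)]
  have hpre : (fun (p : X × (ι → X)) (o : Option ι) => o.elim p.1 p.2) ⁻¹' (Set.pi s t) =
      (if none ∈ s then t none else univ) ×ˢ
        Set.pi (s.eraseNone : Set ι) (fun i => t (some i)) := by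
    ext ⟨x, f⟩
    simp only [mem_preimage, Set.mem_pi, Finset.mem_coe, Option.forall, Option.elim_none,
      Option.elim_some, mem_prod, Finset.mem_eraseNone]
    split_ifs with h <;> simp [h]
  rw [hpre, Measure.prod_prod, Measure.infinitePi_pi _ fun i _ => ht _]
  split_ifs with h
  · have hs : s = Finset.insertNone s.eraseNone := by
      rw [Finset.insertNone_eraseNone, Finset.insert_eq_of_mem h]
    conv_rhs => rw [hs]
    rw [Finset.prod_insertNone]
  · have hs : s = s.eraseNone.map Function.Embedding.some := by
      rw [Finset.map_some_eraseNone, Finset.erase_eq_of_notMem h]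
    conv_rhs => rw [hs]
    rw [Finset.prod_map]
    simp

/-- A vertex is the root, or is given by its first generation ancestor `i` and its position in the
subtree of `i`. -/
def vertexEquiv (d : ℕ) : Option (Fin d × Vertex d) ≃ Vertex d where
  toFun o := o.elim [] fun p => p.2 ++ [p.1]
  invFun v := if h : v = [] then none else some (v.getLast h, v.dropLast)
  left_inv o := by cases o <;> simp
  right_inv v := by
    by_cases h : v = []
    · simp [h]
    · simp [h, List.dropLast_append_getLast]

/-- The clocks in the subtree of the child `i` of the root. -/
def shift {d : ℕ} (i : Fin d) (ω : Clocks d) : Clocks d := fun v => ω (v ++ [i])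

lemma measurable_shift {d : ℕ} (i : Fin d) : Measurable (shift (d := d) i) :=
  measurable_pi_lambda _ fun _ => measurable_pi_apply _

/-- The clocks of the root and those of the subtrees of its children are independent, and the
subtrees have the law of the whole tree. -/
lemma map_root_shift {d : ℕ} (μ : Measure (ℝ × ℝ × ℝ)) [IsProbabilityMeasure μ] :
    (Measure.infinitePi fun _ : Vertex d => μ).map (fun ω => (ω [], fun i => shift i ω)) =
      μ.prod (Measure.pi fun _ : Fin d => Measure.infinitePi fun _ : Vertex d => μ) := by
  have hF : Measurable (fun ω : Clocks d => (ω [], fun i => shift i ω)) :=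
    (measurable_pi_apply _).prodMk (measurable_pi_lambda _ fun i => measurable_shift i)
  have hm : Measurable (fun (p : (ℝ × ℝ × ℝ) × (Fin d × Vertex d → ℝ × ℝ × ℝ))
      (o : Option (Fin d × Vertex d)) => o.elim p.1 p.2) := by
    refine measurable_pi_lambda _ fun o => ?_
    cases o with
    | none => exact measurable_fst
    | some i => exact (measurable_pi_apply i).comp measurable_snd
  rw [← Measure.infinitePi_eq_pi,
    ← Measure.infinitePi_map_curry (fun (_ : Fin d) (_ : Vertex d) => μ)]
  have hmap := Measure.map_prod_map μ
    (Measure.infinitePi fun _ : Fin d × Vertex d => μ) measurable_id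
    (MeasurableEquiv.curry (Fin d) (Vertex d) (ℝ × ℝ × ℝ)).measurable
  rw [Measure.map_id] at hmap
  rw [hmap]
  conv_lhs => rw [← Measure.infinitePi_map_piCongrLeft (fun _ : Vertex d => μ) (vertexEquiv d),
    Measure.map_map hF (by fun_prop), ← infinitePi_option,
    Measure.map_map (hF.comp (by fun_prop)) hm]
  congr 1
  ext1 p
  have key : ∀ (f : Option (Fin d × Vertex d) → ℝ × ℝ × ℝ) (o : Option (Fin d × Vertex d)),
      (MeasurableEquiv.piCongrLeft (fun _ : Vertex d => ℝ × ℝ × ℝ) (vertexEquiv d)) f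
        (vertexEquiv d o) = f o := fun f o =>
    Equiv.piCongrLeft_apply_apply (fun _ : Vertex d => ℝ × ℝ × ℝ) (vertexEquiv d) f o
  refine Prod.ext ?_ ?_
  · exact key _ none
  · funext i v
    exact key _ (some (i, v))

/-- The function `y ↦ 1 - (1 - y)^d`: the probability that one of `d` independent events of
probability `y` occurs. -/
noncomputable def anyOf (d : ℕ) (y : ℝ≥0∞) : ℝ≥0∞ := 1 - (1 - y) ^ d

lemma prob_exists_shift {d : ℕ} (μ : Measure (ℝ × ℝ × ℝ)) [IsProbabilityMeasure μ]
    {F : Set ((ℝ × ℝ × ℝ) × Clocks d)} (hF : MeasurableSet F) :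
    (Measure.infinitePi fun _ : Vertex d => μ) {ω | ∃ i, (ω [], shift i ω) ∈ F} =
      ∫⁻ c, anyOf d ((Measure.infinitePi fun _ : Vertex d => μ) {ω | (c, ω) ∈ F}) ∂μ := by
  set Q := Measure.infinitePi fun _ : Vertex d => μ
  have hm : Measurable (fun ω : Clocks d => (ω [], fun i => shift i ω)) :=
    (measurable_pi_apply _).prodMk (measurable_pi_lambda _ fun i => measurable_shift i)
  have hG : MeasurableSet {p : (ℝ × ℝ × ℝ) × (Fin d → Clocks d) | ∃ i, (p.1, p.2 i) ∈ F} := by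
    rw [ofPred_exists]
    refine MeasurableSet.iUnion fun i => ?_
    exact (measurable_fst.prodMk ((measurable_pi_apply i).comp measurable_snd)) hF
  have h1 : Q {ω | ∃ i, (ω [], shift i ω) ∈ F} =
      (μ.prod (Measure.pi fun _ : Fin d => Q)) {p | ∃ i, (p.1, p.2 i) ∈ F} := by
    rw [← map_root_shift, Measure.map_apply hm hG]
    rfl
  rw [h1, Measure.prod_apply hG]
  refine lintegral_congr fun c => ?_
  have hFc : MeasurableSet {ω | (c, ω) ∈ F} := measurable_prodMk_left hF
  have h2 : Prod.mk c ⁻¹' {p : (ℝ × ℝ × ℝ) × (Fin d → Clocks d) | ∃ i, (p.1, p.2 i) ∈ F} =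
      (Set.pi univ fun _ : Fin d => {ω : Clocks d | (c, ω) ∈ F}ᶜ)ᶜ := by
    ext x
    simp
  rw [h2, prob_compl_eq_one_sub (.univ_pi fun _ => hFc.compl), Measure.pi_pi]
  simp [anyOf, prob_compl_eq_one_sub hFc]

/-! ### Histories along the tree -/

/-- The histories of all vertices when the root turns red at time `r` and the extra site turns blue
at time `b`. -/
noncomputable def timesFrom {d : ℕ} (r b : ℝ≥0∞) (ω : Clocks d) : Vertex d → Times
  | [] => history r b (blueClock ω []) (deathClock ω [])
  | i :: v =>
    history
      (if (timesFrom r b ω v).red + redClock ω (i :: v) < (timesFrom r b ω v).leaveRed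
        then (timesFrom r b ω v).red + redClock ω (i :: v) else ∞)
      (timesFrom r b ω v).blue (blueClock ω (i :: v)) (deathClock ω (i :: v))

lemma times_eq_timesFrom {d : ℕ} (ω : Clocks d) (v : Vertex d) :
    times ω v = timesFrom 0 0 ω v := by
  induction v with
  | nil => rfl
  | cons i v ih => simp only [times, timesFrom, ih]

lemma leaveRed_history (r b W D : ℝ≥0∞) :
    (history r b W D).leaveRed = min (max r b + W) (r + D) := by
  unfold history Times.leaveRed
  rcases lt_or_ge (max r b + W) (r + D) with h | h
  · simp [h, not_le.2 h, h.le]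
  · simp [h, not_lt.2 h]

/-- The time at which the child `i` of the root turns red. -/
noncomputable def childRed {d : ℕ} (r b : ℝ≥0∞) (ω : Clocks d) (i : Fin d) : ℝ≥0∞ :=
  if r + redClock ω [i] < min (max r b + blueClock ω []) (r + deathClock ω [])
    then r + redClock ω [i] else ∞

lemma timesFrom_append {d : ℕ} (r b : ℝ≥0∞) (ω : Clocks d) (i : Fin d) (v : Vertex d) :
    timesFrom r b ω (v ++ [i]) =
      timesFrom (childRed r b ω i) (timesFrom r b ω []).blue (shift i ω) v := by
  induction v with
  | nil =>
    have h : (timesFrom r b ω []).leaveRed =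
        min (max r b + blueClock ω []) (r + deathClock ω []) := by
      simp only [timesFrom, leaveRed_history]
    change history (if (timesFrom r b ω []).red + redClock ω [i] < (timesFrom r b ω []).leaveRed
      then (timesFrom r b ω []).red + redClock ω [i] else ∞) _ _ _ = _
    rw [h]
    rfl
  | cons j v ih =>
    change history (if (timesFrom r b ω (v ++ [i])).red + redClock ω (j :: (v ++ [i])) <
      (timesFrom r b ω (v ++ [i])).leaveRed
      then (timesFrom r b ω (v ++ [i])).red + redClock ω (j :: (v ++ [i])) else ∞)
      (timesFrom r b ω (v ++ [i])).blue _ _ = _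
    rw [ih]
    rfl

lemma blue_eq_top {d : ℕ} {r b : ℝ≥0∞} (h : r = ∞ ∨ b = ∞) (ω : Clocks d) (v : Vertex d) :
    (timesFrom r b ω v).blue = ∞ := by
  induction v with
  | nil => rcases h with rfl | rfl <;> simp [timesFrom, history]
  | cons i v ih =>
    rw [timesFrom]
    simp [history, ih]

lemma red_top {d : ℕ} (b : ℝ≥0∞) (ω : Clocks d) (v : Vertex d) :
    (timesFrom ∞ b ω v).red = ∞ := by
  induction v with
  | nil => rfl
  | cons i v ih =>
    rw [timesFrom]
    simp [history, ih]

/-- Blue reaches generation `n` when the root turns red at time `0` and its parent turns blue at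
time `t`: the parent of a vertex turns blue `t` time units after that vertex turned red, so blue
takes the vertex if `t + W < D`, and then the child `i` is reached by red in time if its red clock
`R` satisfies `R < t + W`, the delay of the child being `t + W - R`. -/
def BlueAt {d : ℕ} : ℕ → ℝ → Clocks d → Prop
  | 0, t, ω => t + (ω []).2.1 < (ω []).2.2
  | n + 1, t, ω => ∃ i : Fin d, t + (ω []).2.1 < (ω []).2.2 ∧
      (shift i ω []).1 < t + (ω []).2.1 ∧
        BlueAt n (t + (ω []).2.1 - (shift i ω []).1) (shift i ω)

/-- Red reaches generation `n` when there is no blue. -/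
def RedAt {d : ℕ} : ℕ → Clocks d → Prop
  | 0, _ => True
  | n + 1, ω => ∃ i : Fin d, (shift i ω []).1 < (ω []).2.2 ∧ RedAt n (shift i ω)

/-- All waiting times are nonnegative, as they are almost surely. -/
def Nonneg {d : ℕ} (ω : Clocks d) : Prop := ∀ v, 0 ≤ (ω v).1 ∧ 0 ≤ (ω v).2.1 ∧ 0 ≤ (ω v).2.2

lemma Nonneg.shift {d : ℕ} {ω : Clocks d} (h : Nonneg ω) (i : Fin d) : Nonneg (shift i ω) :=
  fun v => h (v ++ [i])

lemma exists_length_succ {d : ℕ} {n : ℕ} {p : Vertex d → Prop} :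
    (∃ v, v.length = n + 1 ∧ p v) ↔ ∃ (i : Fin d) (v : Vertex d), v.length = n ∧ p (v ++ [i]) := by
  constructor
  · rintro ⟨v, hv, hp⟩
    have hne : v ≠ [] := by rintro rfl; simp at hv
    refine ⟨v.getLast hne, v.dropLast, by simp [hv], ?_⟩
    rwa [List.dropLast_append_getLast]
  · rintro ⟨i, v, hv, hp⟩
    exact ⟨v ++ [i], by simp [hv], hp⟩

lemma max_add_blueClock {d : ℕ} {t : ℝ} (ht : 0 ≤ t) (r : ℝ≥0∞) {ω : Clocks d}
    (hω : Nonneg ω) :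
    max r (r + ENNReal.ofReal t) + blueClock ω [] = r + ENNReal.ofReal (t + (ω []).2.1) := by
  rw [max_eq_right le_self_add, add_assoc, blueClock, ← ENNReal.ofReal_add ht (hω []).2.1]

lemma add_lt_add_deathClock_iff {d : ℕ} {t : ℝ} (ht : 0 ≤ t) {r : ℝ≥0∞} (hr : r ≠ ∞)
    {ω : Clocks d} (hω : Nonneg ω) :
    r + ENNReal.ofReal (t + (ω []).2.1) < r + deathClock ω [] ↔
      t + (ω []).2.1 < (ω []).2.2 := by
  have hW := (hω []).2.1
  rw [ENNReal.add_lt_add_iff_left hr, deathClock, ENNReal.ofReal_lt_ofReal_iff']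
  exact ⟨fun h => h.1, fun h => ⟨h, by linarith⟩⟩

lemma root_blue {d : ℕ} {t : ℝ} (ht : 0 ≤ t) {r : ℝ≥0∞} (hr : r ≠ ∞)
    {ω : Clocks d} (hω : Nonneg ω) :
    (timesFrom r (r + ENNReal.ofReal t) ω []).blue =
      if t + (ω []).2.1 < (ω []).2.2 then r + ENNReal.ofReal (t + (ω []).2.1) else ∞ := by
  simp only [timesFrom, history, max_add_blueClock ht r hω, add_lt_add_deathClock_iff ht hr hω]

lemma exists_blue_iff {d : ℕ} (n : ℕ) {t : ℝ} (ht : 0 ≤ t) {r : ℝ≥0∞} (hr : r ≠ ∞)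
    {ω : Clocks d} (hω : Nonneg ω) :
    (∃ v : Vertex d, v.length = n ∧ (timesFrom r (r + ENNReal.ofReal t) ω v).blue ≠ ∞) ↔
      BlueAt n t ω := by
  induction n generalizing t r ω with
  | zero =>
    simp only [List.length_eq_zero_iff, exists_eq_left, BlueAt, root_blue ht hr hω]
    split_ifs with h <;> simp [h, hr]
  | succ n ih =>
    rw [exists_length_succ, BlueAt]
    refine exists_congr fun i => ?_
    simp only [timesFrom_append, root_blue ht hr hω]
    by_cases h : t + (ω []).2.1 < (ω []).2.2
    · have hR : 0 ≤ (shift i ω []).1 := ((hω.shift i) []).1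
      have hred : childRed r (r + ENNReal.ofReal t) ω i =
          if (shift i ω []).1 < t + (ω []).2.1 then r + ENNReal.ofReal (shift i ω []).1
            else ∞ := by
        unfold childRed
        rw [max_add_blueClock ht r hω,
          min_eq_left ((add_lt_add_deathClock_iff ht hr hω).2 h).le]
        have : r + redClock ω [i] < r + ENNReal.ofReal (t + (ω []).2.1) ↔
            (shift i ω []).1 < t + (ω []).2.1 := by
          rw [ENNReal.add_lt_add_iff_left hr, redClock, ENNReal.ofReal_lt_ofReal_iff']
          exact ⟨fun h => h.1, fun h => ⟨h, lt_of_le_of_lt hR h⟩⟩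
        simp only [this]
        rfl
      rw [hred, if_pos h]
      by_cases h2 : (shift i ω []).1 < t + (ω []).2.1
      · have h3 : r + ENNReal.ofReal (t + (ω []).2.1) = r + ENNReal.ofReal (shift i ω []).1 +
            ENNReal.ofReal (t + (ω []).2.1 - (shift i ω []).1) := by
          rw [add_assoc, ← ENNReal.ofReal_add hR (by linarith)]
          congr 2
          ring
        rw [if_pos h2, h3, ih (by linarith) (by simp [hr]) (hω.shift i)]
        simp [h, h2]
      · simp [h2, blue_eq_top (Or.inl rfl)]
    · simp [h, blue_eq_top (Or.inr rfl)]

lemma redAt_of_red_ne_top {d : ℕ} (r b : ℝ≥0∞) {ω : Clocks d} {v : Vertex d}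
    (hv : (timesFrom r b ω v).red ≠ ∞) : RedAt v.length ω := by
  obtain ⟨n, hn⟩ : ∃ n, v.length = n := ⟨_, rfl⟩
  rw [hn]
  induction n generalizing r b ω v with
  | zero => trivial
  | succ n ih =>
    obtain ⟨i, w, hw, h⟩ := exists_length_succ.1
      (⟨v, hn, hv⟩ : ∃ v : Vertex d, v.length = n + 1 ∧ (timesFrom r b ω v).red ≠ ∞)
    rw [timesFrom_append] at h
    refine ⟨i, ?_, ih _ _ h hw⟩
    have hc : childRed r b ω i ≠ ∞ := by
      intro hc
      rw [hc, red_top] at h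
      exact h rfl
    unfold childRed at hc
    split_ifs at hc with h1
    · have h2 := lt_of_lt_of_le h1 (min_le_right _ _)
      have h3 : redClock ω [i] < deathClock ω [] := lt_of_add_lt_add_left h2
      exact (ENNReal.ofReal_lt_ofReal_iff'.1 h3).1
    · exact absurd rfl hc

lemma exists_red_of_redAt {d : ℕ} {n : ℕ} {r : ℝ≥0∞} (hr : r ≠ ∞) {ω : Clocks d}
    (hω : Nonneg ω) (h : RedAt n ω) :
    ∃ v : Vertex d, v.length = n ∧ (timesFrom r ∞ ω v).red ≠ ∞ := by
  induction n generalizing r ω with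
  | zero => exact ⟨[], rfl, hr⟩
  | succ n ih =>
    obtain ⟨i, hi, h⟩ := h
    refine exists_length_succ.2 ⟨i, ?_⟩
    simp only [timesFrom_append, blue_eq_top (Or.inr rfl)]
    refine ih ?_ (hω.shift i) h
    have hlt : redClock ω [i] < deathClock ω [] :=
      ENNReal.ofReal_lt_ofReal_iff'.2 ⟨hi, lt_of_le_of_lt ((hω.shift i) []).1 hi⟩
    have : r + redClock ω [i] < min (max r ∞ + blueClock ω []) (r + deathClock ω []) := by
      simp only [max_top_right, top_add, le_top, inf_of_le_right]
      rwa [ENNReal.add_lt_add_iff_left hr]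
    rw [childRed, if_pos this]
    simp [hr, redClock]

/-- If the root dies before blue takes it, having infected the child `i`, then blue never enters the
subtree of `i`. -/
lemma exists_red_of_root_dead {d : ℕ} {n : ℕ} {ω : Clocks d} (hω : Nonneg ω) {i : Fin d}
    (h1 : (ω []).2.2 < (ω []).2.1) (h2 : (shift i ω []).1 < (ω []).2.2)
    (h3 : RedAt n (shift i ω)) :
    ∃ v : Vertex d, v.length = n + 1 ∧ (times ω v).red ≠ ∞ := by
  refine exists_length_succ.2 ⟨i, ?_⟩
  have hWD : deathClock ω [] ≤ blueClock ω [] := ENNReal.ofReal_le_ofReal h1.le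
  have hb : (timesFrom 0 0 ω []).blue = ∞ := by
    simp [timesFrom, history, hWD]
  simp only [times_eq_timesFrom, timesFrom_append, hb]
  refine exists_red_of_redAt ?_ (hω.shift i) h3
  have hlt : redClock ω [i] < deathClock ω [] :=
    ENNReal.ofReal_lt_ofReal_iff'.2 ⟨h2, lt_of_le_of_lt ((hω.shift i) []).1 h2⟩
  have : 0 + redClock ω [i] < min (max 0 0 + blueClock ω []) (0 + deathClock ω []) := by
    simp only [zero_add, max_self, min_eq_right hWD]
    exact hlt
  rw [childRed, if_pos this]
  simp [redClock]

lemma exists_length_of_infinite {d : ℕ} {S : Set (Site d)} {p : Vertex d → Prop}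
    (hS : ∀ v, some v ∈ S → p v) (hp : ∀ i v, p (i :: v) → p v) (h : S.Infinite) (n : ℕ) :
    ∃ v : Vertex d, v.length = n ∧ p v := by
  by_contra! hn
  have hlt : ∀ v, p v → v.length < n := by
    intro v
    induction v with
    | nil =>
      intro hv
      by_contra hlen
      exact hn [] (by simpa [eq_comm] using hlen) hv
    | cons i v ih =>
      intro hv
      have h1 := ih (hp i v hv)
      have h2 : (i :: v).length ≠ n := fun h2 => hn _ h2 hv
      rw [List.length_cons] at h2 ⊢
      omega
  refine h (Set.Finite.subset (((List.finite_length_lt (Fin d) n).image some).insert none) ?_)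
  rintro (_ | v) hv
  · exact mem_insert _ _
  · exact mem_insert_of_mem _ ⟨v, hlt v (hS v hv), rfl⟩

lemma infinite_of_exists_length {d : ℕ} {S : Set (Site d)} {p : Vertex d → Prop}
    (hS : ∀ i v, p (i :: v) → some v ∈ S) (h : ∀ n, ∃ v : Vertex d, v.length = n + 1 ∧ p v) :
    S.Infinite := by
  intro hfin
  have hfin2 : ((fun v : Vertex d => v.length) '' (some ⁻¹' S)).Finite :=
    (hfin.preimage (Option.some_injective _).injOn).image _
  refine Set.infinite_univ (hfin2.subset fun n _ => ?_)
  obtain ⟨v, hv, hpv⟩ := h n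
  match v, hv, hpv with
  | i :: w, hv, hpv => exact ⟨w, hS i w hpv, by simpa using hv⟩

lemma red_le_blue (r b W D : ℝ≥0∞) : (history r b W D).red ≤ (history r b W D).blue := by
  unfold history
  simp only
  split_ifs
  · exact (le_max_left _ _).trans le_self_add
  · exact le_top

lemma timesFrom_eq_history {d : ℕ} (r b : ℝ≥0∞) (ω : Clocks d) (v : Vertex d) :
    ∃ r' b' W D, timesFrom r b ω v = history r' b' W D := by
  cases v with
  | nil => exact ⟨_, _, _, _, rfl⟩
  | cons i v => exact ⟨_, _, _, _, rfl⟩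

lemma some_mem_blueSites_iff {d : ℕ} (ω : Clocks d) (v : Vertex d) :
    some v ∈ blueSites ω ↔ (times ω v).blue ≠ ∞ := by
  rw [times_eq_timesFrom]
  simp only [blueSites, mem_ofPred_eq, state, times_eq_timesFrom]
  constructor
  · rintro ⟨t, ht⟩ hb
    unfold Times.stateAt at ht
    rw [hb] at ht
    split_ifs at ht
    simp_all
  · intro hb
    refine ⟨(timesFrom 0 0 ω v).blue.toNNReal, ?_⟩
    obtain ⟨r', b', W, D, h⟩ := timesFrom_eq_history 0 0 ω v
    have := red_le_blue r' b' W D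
    rw [← h] at this
    unfold Times.stateAt
    rw [ENNReal.coe_toNNReal hb, if_neg (not_lt.2 this), if_pos le_rfl]

lemma red_ne_top_of_mem_redSites {d : ℕ} {ω : Clocks d} {v : Vertex d}
    (h : some v ∈ redSites ω) : (times ω v).red ≠ ∞ := by
  obtain ⟨t, ht⟩ := h
  intro hr
  simp [state, Times.stateAt, hr] at ht

lemma mem_redSites_of_child {d : ℕ} {ω : Clocks d} {i : Fin d} {v : Vertex d}
    (h : (times ω (i :: v)).red ≠ ∞) : some v ∈ redSites ω := by
  have h1 : (times ω v).red + redClock ω (i :: v) < (times ω v).leaveRed := by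
    by_contra hc
    rw [times, if_neg hc] at h
    exact h rfl
  have h2 : (times ω v).red < (times ω v).leaveRed := lt_of_le_of_lt le_self_add h1
  refine ⟨(times ω v).red.toNNReal, ?_⟩
  simp only [state, Times.stateAt]
  rw [ENNReal.coe_toNNReal h2.ne_top, if_neg (lt_irrefl _),
    if_neg (not_le.2 (h2.trans_le (min_le_left _ _))),
    if_neg (not_le.2 (h2.trans_le (min_le_right _ _)))]

lemma red_ne_top_of_child {d : ℕ} {ω : Clocks d} {i : Fin d} {v : Vertex d}
    (h : (times ω (i :: v)).red ≠ ∞) : (times ω v).red ≠ ∞ :=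
  red_ne_top_of_mem_redSites (mem_redSites_of_child h)

lemma blue_ne_top_of_child {d : ℕ} {ω : Clocks d} {i : Fin d} {v : Vertex d}
    (h : (times ω (i :: v)).blue ≠ ∞) : (times ω v).blue ≠ ∞ := by
  intro hb
  rw [times, hb] at h
  simp [history] at h

lemma mem_eventB_iff {d : ℕ} {ω : Clocks d} (hω : Nonneg ω) :
    ω ∈ eventB d ↔ ∀ n, BlueAt n 0 ω := by
  have key : ∀ n, (∃ v : Vertex d, v.length = n ∧ (times ω v).blue ≠ ∞) ↔ BlueAt n 0 ω := by
    intro n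
    have := exists_blue_iff n le_rfl (r := 0) (by simp) hω
    simpa only [ENNReal.ofReal_zero, add_zero, ← times_eq_timesFrom] using this
  constructor
  · intro h n
    exact (key n).1 (exists_length_of_infinite (fun v => (some_mem_blueSites_iff ω v).1)
      (fun _ _ => blue_ne_top_of_child) h n)
  · intro h
    exact infinite_of_exists_length
      (fun i v hv => (some_mem_blueSites_iff ω v).2 (blue_ne_top_of_child hv))
      fun n => (key (n + 1)).2 (h (n + 1))

lemma redAt_of_mem_eventA {d : ℕ} {ω : Clocks d} (h : ω ∈ eventA d) (n : ℕ) : RedAt n ω := by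
  obtain ⟨v, hv, hr⟩ := exists_length_of_infinite (fun v => red_ne_top_of_mem_redSites)
    (fun _ _ => red_ne_top_of_child) h n
  rw [times_eq_timesFrom] at hr
  exact hv ▸ redAt_of_red_ne_top _ _ hr

lemma RedAt.mono {d : ℕ} {n : ℕ} {ω : Clocks d} (h : RedAt (n + 1) ω) : RedAt n ω := by
  induction n generalizing ω with
  | zero => trivial
  | succ n ih =>
    obtain ⟨i, h1, h2⟩ := h
    exact ⟨i, h1, ih h2⟩

lemma BlueAt.mono {d : ℕ} {n : ℕ} {t : ℝ} {ω : Clocks d} (h : BlueAt (n + 1) t ω) :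
    BlueAt n t ω := by
  induction n generalizing t ω with
  | zero =>
    obtain ⟨i, h1, -⟩ := h
    exact h1
  | succ n ih =>
    obtain ⟨i, h1, h2, h3⟩ := h
    exact ⟨i, h1, h2, ih h3⟩

/-- Red survives if the root dies before blue takes it, having infected a child whose subtree
carries a surviving red process without blue. -/
lemma mem_eventA_of_root_dead {d : ℕ} {ω : Clocks d} (hω : Nonneg ω)
    (h : ∀ n, ∃ i : Fin d, (ω []).2.2 < (ω []).2.1 ∧ (shift i ω []).1 < (ω []).2.2 ∧
      RedAt n (shift i ω)) : ω ∈ eventA d := by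
  refine infinite_of_exists_length (p := fun v => (times ω v).red ≠ ∞)
    (fun i v hv => mem_redSites_of_child hv) fun n => ?_
  obtain ⟨i, h1, h2, h3⟩ := h n
  exact exists_red_of_root_dead hω h1 h2 h3

/-! ### Exponential clocks -/

lemma lintegral_expMeasure {r : ℝ} {f : ℝ → ℝ≥0∞} (hf : Measurable f) :
    ∫⁻ x, f x ∂expMeasure r = ∫⁻ x in Ioi 0, ENNReal.ofReal (r * Real.exp (-(r * x))) * f x := by
  have hpdf : Measurable (exponentialPDF r) :=
    (measurable_exponentialPDFReal r).ennreal_ofReal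
  have h1 : ∫⁻ x, f x ∂expMeasure r = ∫⁻ x, exponentialPDF r x * f x :=
    lintegral_withDensity_eq_lintegral_mul _ hpdf hf
  rw [h1, ← setLIntegral_congr Ioi_ae_eq_Ici.symm, ← lintegral_indicator measurableSet_Ici]
  refine lintegral_congr fun x => ?_
  by_cases hx : 0 ≤ x
  · rw [indicator_of_mem (mem_Ici.2 hx), exponentialPDF_of_nonneg hx]
  · rw [indicator_of_notMem (by simpa using hx), exponentialPDF_of_neg (not_le.1 hx), zero_mul]

lemma expMeasure_Iio {r : ℝ} (hr : 0 < r) {x : ℝ} (hx : 0 ≤ x) :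
    expMeasure r (Iio x) = ENNReal.ofReal (1 - Real.exp (-(r * x))) := by
  have := isProbabilityMeasure_expMeasure hr
  have hna : expMeasure r {x} = 0 := by
    rw [expMeasure, gammaMeasure]
    exact withDensity_absolutelyContinuous _ _ (by simp)
  have h1 : expMeasure r (Iio x) = expMeasure r (Iic x) := by
    refine le_antisymm (measure_mono Iio_subset_Iic_self) ?_
    rw [← Iio_union_right]
    refine (measure_union_le _ _).trans ?_
    rw [hna, add_zero]
  have h2 := cdf_expMeasure_eq hr x
  rw [if_pos hx, cdf_eq_real] at h2
  rw [h1, ← h2, ofReal_measureReal]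

lemma measurable_expMeasure_Iio {lam : ℝ} : Measurable fun x => expMeasure lam (Iio x) :=
  Monotone.measurable fun _ _ h => measure_mono (Iio_subset_Iio h)

lemma expMeasure_Ioi {r : ℝ} (hr : 0 < r) {x : ℝ} (hx : 0 ≤ x) :
    expMeasure r (Ioi x) = ENNReal.ofReal (Real.exp (-(r * x))) := by
  have := isProbabilityMeasure_expMeasure hr
  have h2 := cdf_expMeasure_eq hr x
  rw [if_pos hx, cdf_eq_real] at h2
  rw [← compl_Iic, prob_compl_eq_one_sub measurableSet_Iic, ← ofReal_measureReal, h2,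
    ← ENNReal.ofReal_one, ← ENNReal.ofReal_sub _ ?_]
  · congr 1
    ring
  · have : Real.exp (-(r * x)) ≤ 1 := Real.exp_le_one_iff.2 (by nlinarith)
    linarith

lemma ae_nonneg_expMeasure {r : ℝ} : ∀ᵐ x ∂expMeasure r, 0 ≤ x := by
  have : expMeasure r (Iio 0) = 0 := by
    rw [expMeasure, gammaMeasure, withDensity_apply _ measurableSet_Iio]
    exact lintegral_exponentialPDF_of_nonpos le_rfl
  rw [ae_iff]
  convert! this using 2
  ext x
  simp

/-! ### The two integral operators -/

/-- With `g z` the weight of the children of a vertex that blue takes `z` time units after red did,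
`blueOp rho g t` is the expected weight when the delay of blue is `t`: blue crosses the edge at
rate `1`, and the vertex survives until time `z` with probability `exp (-rho z)`. -/
noncomputable def blueOp (rho : ℝ) (g : ℝ → ℝ≥0∞) (t : ℝ) : ℝ≥0∞ :=
  ∫⁻ z in Ioi t, ENNReal.ofReal (Real.exp (t - z) * Real.exp (-(rho * z))) * g z

/-- With `h x` the weight of a vertex of delay `x`, `redOp lam h u` is the expected weight of a
child whose parent stays red for a time `u`: red crosses the edge at rate `lam`. -/
noncomputable def redOp (lam : ℝ) (h : ℝ → ℝ≥0∞) (u : ℝ) : ℝ≥0∞ :=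
  ∫⁻ x in Ioo 0 u, ENNReal.ofReal (lam * Real.exp (-(lam * (u - x)))) * h x

lemma measurableSet_and {α : Type*} [MeasurableSpace α] {p q : α → Prop}
    (hp : MeasurableSet {a | p a}) (hq : MeasurableSet {a | q a}) :
    MeasurableSet {a | p a ∧ q a} := hp.inter hq

lemma measurable_blueOp (rho : ℝ) {g : ℝ → ℝ≥0∞} (hg : Measurable g) :
    Measurable (blueOp rho g) := by
  have : blueOp rho g = fun t => ∫⁻ z, {p : ℝ × ℝ | p.1 < p.2}.indicator (fun p =>
      ENNReal.ofReal (Real.exp (p.1 - p.2) * Real.exp (-(rho * p.2))) * g p.2) (t, z) := by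
    funext t
    rw [blueOp, ← lintegral_indicator measurableSet_Ioi]
    rfl
  rw [this]
  refine Measurable.lintegral_prod_right' ?_
  refine Measurable.indicator ?_ (measurableSet_lt measurable_fst measurable_snd)
  have : Measurable fun p : ℝ × ℝ => g p.2 := hg.comp measurable_snd
  fun_prop

lemma measurable_redOp (lam : ℝ) {h : ℝ → ℝ≥0∞} (hh : Measurable h) :
    Measurable (redOp lam h) := by
  have : redOp lam h = fun u => ∫⁻ x, {p : ℝ × ℝ | 0 < p.2 ∧ p.2 < p.1}.indicator (fun p =>
      ENNReal.ofReal (lam * Real.exp (-(lam * (p.1 - p.2)))) * h p.2) (u, x) := by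
    funext u
    rw [redOp, ← lintegral_indicator measurableSet_Ioo]
    rfl
  rw [this]
  refine Measurable.lintegral_prod_right' ?_
  refine Measurable.indicator ?_ (measurableSet_and (measurableSet_lt measurable_const measurable_snd)
    (measurableSet_lt measurable_snd measurable_fst))
  have : Measurable fun p : ℝ × ℝ => h p.2 := hh.comp measurable_snd
  fun_prop

lemma lintegral_blue {rho : ℝ} (hrho : 0 < rho) {t : ℝ} (ht : 0 ≤ t) {g : ℝ → ℝ≥0∞}
    (hg : Measurable g) :
    ∫⁻ c, (if t + c.1 < c.2 then g (t + c.1) else 0) ∂((expMeasure 1).prod (expMeasure rho)) =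
      blueOp rho g t := by
  have := isProbabilityMeasure_expMeasure hrho
  have := isProbabilityMeasure_expMeasure one_pos
  have hm : Measurable fun c : ℝ × ℝ => if t + c.1 < c.2 then g (t + c.1) else 0 :=
    Measurable.ite (measurableSet_lt (by fun_prop) (by fun_prop)) (by fun_prop) measurable_const
  rw [lintegral_prod _ hm.aemeasurable]
  have h1 : ∀ w, ∫⁻ D, (if t + w < D then g (t + w) else 0) ∂expMeasure rho =
      g (t + w) * expMeasure rho (Ioi (t + w)) := by
    intro w
    rw [← lintegral_indicator_const measurableSet_Ioi]
    rfl
  have hm2 : Measurable fun w => g (t + w) * expMeasure rho (Ioi (t + w)) := by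
    have h := hm.lintegral_prod_right' (ν := expMeasure rho)
    simpa only [h1] using h
  simp only [h1]
  rw [lintegral_expMeasure hm2, blueOp, ← lintegral_indicator measurableSet_Ioi,
    ← lintegral_indicator measurableSet_Ioi]
  conv_rhs => rw [← lintegral_add_left_eq_self _ t]
  refine lintegral_congr fun w => ?_
  by_cases hw : 0 < w
  · rw [indicator_of_mem (mem_Ioi.2 hw), indicator_of_mem (by simpa using hw),
      expMeasure_Ioi hrho (by linarith), ENNReal.ofReal_mul (Real.exp_nonneg _)]
    rw [mul_comm (g _), mul_assoc]
    congr 3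
    rw [one_mul, one_mul]
    congr 1
    ring
  · rw [indicator_of_notMem (by simpa using hw), indicator_of_notMem (by simpa using hw)]

lemma lintegral_clockLaw_blue {lam rho : ℝ} (hlam : 0 < lam) (hrho : 0 < rho) {t : ℝ}
    (ht : 0 ≤ t) {g : ℝ → ℝ≥0∞} (hg : Measurable g) :
    ∫⁻ c, (if t + c.2.1 < c.2.2 then g (t + c.2.1) else 0) ∂clockLaw lam rho =
      blueOp rho g t := by
  have := isProbabilityMeasure_expMeasure hlam
  have := isProbabilityMeasure_expMeasure hrho
  have := isProbabilityMeasure_expMeasure one_pos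
  have hm : Measurable fun c : ℝ × ℝ × ℝ => if t + c.2.1 < c.2.2 then g (t + c.2.1) else 0 :=
    Measurable.ite (measurableSet_lt (by fun_prop) (by fun_prop)) (by fun_prop) measurable_const
  rw [clockLaw, lintegral_prod _ hm.aemeasurable]
  simp only [lintegral_blue hrho ht hg, lintegral_const, measure_univ, mul_one]

lemma lintegral_clockLaw_red_blue {lam rho : ℝ} (hlam : 0 < lam) (hrho : 0 < rho) (u : ℝ)
    {g : ℝ → ℝ≥0∞} (hg : Measurable g) :
    ∫⁻ c, (if c.1 < u ∧ u - c.1 + c.2.1 < c.2.2 then g (u - c.1 + c.2.1) else 0)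
      ∂clockLaw lam rho = redOp lam (blueOp rho g) u := by
  have := isProbabilityMeasure_expMeasure hlam
  have := isProbabilityMeasure_expMeasure hrho
  have := isProbabilityMeasure_expMeasure one_pos
  have hm : Measurable fun c : ℝ × ℝ × ℝ =>
      if c.1 < u ∧ u - c.1 + c.2.1 < c.2.2 then g (u - c.1 + c.2.1) else 0 :=
    Measurable.ite (measurableSet_and (measurableSet_lt (by fun_prop) (by fun_prop))
      (measurableSet_lt (by fun_prop) (by fun_prop))) (by fun_prop) measurable_const
  rw [clockLaw, lintegral_prod _ hm.aemeasurable]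
  have h1 : ∀ r, ∫⁻ c, (if r < u ∧ u - r + c.1 < c.2 then g (u - r + c.1) else 0)
      ∂((expMeasure 1).prod (expMeasure rho)) = (Iio u).indicator
        (fun r => blueOp rho g (u - r)) r := by
    intro r
    by_cases hr : r < u
    · simp only [hr, true_and]
      rw [lintegral_blue hrho (by linarith) hg, indicator_of_mem (mem_Iio.2 hr)]
    · simp [hr]
  have hmb := measurable_blueOp rho hg
  simp only [h1]
  rw [lintegral_expMeasure ((show Measurable fun r => blueOp rho g (u - r) from
    hmb.comp (by fun_prop)).indicator measurableSet_Iio), redOp,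
    ← lintegral_indicator measurableSet_Ioi, ← lintegral_indicator measurableSet_Ioo]
  conv_rhs => rw [← lintegral_sub_left_eq_self _ u]
  refine lintegral_congr fun r => ?_
  by_cases hr : 0 < r
  · by_cases hr2 : r < u
    · rw [indicator_of_mem (mem_Ioi.2 hr), indicator_of_mem (mem_Iio.2 hr2),
        indicator_of_mem (by simp [hr, hr2]), sub_sub_cancel]
    · rw [indicator_of_mem (mem_Ioi.2 hr), indicator_of_notMem (by simpa using hr2),
        indicator_of_notMem (by simp [not_lt.1 hr2]), mul_zero]
  · rw [indicator_of_notMem (by simpa using hr), indicator_of_notMem (by simp [hr])]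

/-! ### Recursions for the survival probabilities -/

lemma measurableSet_blueAt {d : ℕ} (n : ℕ) :
    MeasurableSet {p : ℝ × Clocks d | BlueAt n p.1 p.2} := by
  have hroot : Measurable fun p : ℝ × Clocks d => p.2 [] :=
    (measurable_pi_apply []).comp measurable_snd
  have h0 : MeasurableSet {p : ℝ × Clocks d | p.1 + (p.2 []).2.1 < (p.2 []).2.2} :=
    measurableSet_lt (by fun_prop) (by fun_prop)
  induction n with
  | zero => exact h0
  | succ n ih =>
    simp only [BlueAt, ofPred_exists]
    refine MeasurableSet.iUnion fun i => measurableSet_and h0 ?_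
    have hs : Measurable fun p : ℝ × Clocks d => shift i p.2 :=
      (measurable_shift i).comp measurable_snd
    have hs0 : Measurable fun p : ℝ × Clocks d => shift i p.2 [] :=
      (measurable_pi_apply []).comp hs
    refine measurableSet_and (measurableSet_lt (by fun_prop) (by fun_prop)) ?_
    have hf : Measurable fun p : ℝ × Clocks d =>
        (p.1 + (p.2 []).2.1 - (shift i p.2 []).1, shift i p.2) := by fun_prop
    exact hf ih

lemma measurableSet_blueAt_of_red {d : ℕ} (n : ℕ) :
    MeasurableSet {p : ℝ × Clocks d | (p.2 []).1 < p.1 ∧ BlueAt n (p.1 - (p.2 []).1) p.2} := by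
  have hroot : Measurable fun p : ℝ × Clocks d => p.2 [] :=
    (measurable_pi_apply []).comp measurable_snd
  have hf : Measurable fun p : ℝ × Clocks d => (p.1 - (p.2 []).1, p.2) := by fun_prop
  exact measurableSet_and (measurableSet_lt (by fun_prop) (by fun_prop)) (hf (measurableSet_blueAt n))

lemma measurableSet_redAt {d : ℕ} (n : ℕ) : MeasurableSet {ω : Clocks d | RedAt n ω} := by
  induction n with
  | zero => simp [RedAt]
  | succ n ih =>
    simp only [RedAt, ofPred_exists]
    refine MeasurableSet.iUnion fun i => ?_
    have hs0 : Measurable fun ω : Clocks d => shift i ω [] :=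
      (measurable_pi_apply []).comp (measurable_shift i)
    have hroot : Measurable fun ω : Clocks d => ω [] := measurable_pi_apply []
    exact measurableSet_and (measurableSet_lt (by fun_prop) (by fun_prop)) (measurable_shift i ih)

/-- The probability that, along the edge to a vertex whose parent stays red for a time `u` and is
then taken by blue, red crosses in time and blue then reaches the `n`-th generation below it. -/
noncomputable def reach (d : ℕ) (lam rho : ℝ) (n : ℕ) (u : ℝ) : ℝ≥0∞ :=
  P d lam rho {ω | (ω []).1 < u ∧ BlueAt n (u - (ω []).1) ω}

section recursions

variable {d : ℕ} {lam rho : ℝ}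

lemma isProbabilityMeasure_P (hlam : 0 < lam) (hrho : 0 < rho) :
    IsProbabilityMeasure (P d lam rho) := by
  have := isProbabilityMeasure_clockLaw hlam hrho
  exact inferInstanceAs
    (IsProbabilityMeasure (Measure.infinitePi fun _ : Vertex d => clockLaw lam rho))

lemma map_root (hlam : 0 < lam) (hrho : 0 < rho) :
    MeasurePreserving (fun ω : Clocks d => ω []) (P d lam rho) (clockLaw lam rho) := by
  have := isProbabilityMeasure_clockLaw hlam hrho
  exact measurePreserving_eval_infinitePi (fun _ : Vertex d => clockLaw lam rho) []

lemma measurable_anyOf {f : ℝ → ℝ≥0∞} (hf : Measurable f) :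
    Measurable fun x => anyOf d (f x) := by
  unfold anyOf
  fun_prop

lemma measurable_reach (hlam : 0 < lam) (hrho : 0 < rho) (n : ℕ) :
    Measurable (reach d lam rho n) := by
  have := isProbabilityMeasure_P (d := d) hlam hrho
  exact measurable_measure_prodMk_left (measurableSet_blueAt_of_red n)

lemma reach_le_one (hlam : 0 < lam) (hrho : 0 < rho) (n : ℕ) (u : ℝ) :
    reach d lam rho n u ≤ 1 := by
  have := isProbabilityMeasure_P (d := d) hlam hrho
  exact prob_le_one

@[simp] lemma anyOf_zero : anyOf d 0 = 0 := by simp [anyOf]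

lemma prob_blueAt_succ (hlam : 0 < lam) (hrho : 0 < rho) (n : ℕ) {t : ℝ} (ht : 0 ≤ t) :
    P d lam rho {ω | BlueAt (n + 1) t ω} =
      blueOp rho (fun u => anyOf d (reach d lam rho n u)) t := by
  have := isProbabilityMeasure_clockLaw hlam hrho
  have hF : MeasurableSet {p : (ℝ × ℝ × ℝ) × Clocks d | t + p.1.2.1 < p.1.2.2 ∧
      (p.2 []).1 < t + p.1.2.1 ∧ BlueAt n (t + p.1.2.1 - (p.2 []).1) p.2} := by
    refine measurableSet_and (measurableSet_lt (by fun_prop) (by fun_prop)) ?_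
    have hf : Measurable fun p : (ℝ × ℝ × ℝ) × Clocks d => (t + p.1.2.1, p.2) := by fun_prop
    exact hf (measurableSet_blueAt_of_red n)
  refine (prob_exists_shift (clockLaw lam rho) hF).trans ?_
  rw [← lintegral_clockLaw_blue hlam hrho ht (measurable_anyOf (measurable_reach hlam hrho n))]
  refine lintegral_congr fun c => ?_
  by_cases h : t + c.2.1 < c.2.2
  · simp only [mem_ofPred_eq, h, true_and, if_true]
    rfl
  · simp [h]

lemma reach_succ (hlam : 0 < lam) (hrho : 0 < rho) (n : ℕ) (u : ℝ) :
    reach d lam rho (n + 1) u =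
      redOp lam (blueOp rho fun z => anyOf d (reach d lam rho n z)) u := by
  have := isProbabilityMeasure_clockLaw hlam hrho
  have hF : MeasurableSet {p : (ℝ × ℝ × ℝ) × Clocks d |
      (p.1.1 < u ∧ u - p.1.1 + p.1.2.1 < p.1.2.2) ∧
      (p.2 []).1 < u - p.1.1 + p.1.2.1 ∧ BlueAt n (u - p.1.1 + p.1.2.1 - (p.2 []).1) p.2} := by
    refine measurableSet_and (measurableSet_and (measurableSet_lt (by fun_prop) (by fun_prop))
      (measurableSet_lt (by fun_prop) (by fun_prop))) ?_
    have hf : Measurable fun p : (ℝ × ℝ × ℝ) × Clocks d => (u - p.1.1 + p.1.2.1, p.2) := by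
      fun_prop
    exact hf (measurableSet_blueAt_of_red n)
  have h1 : reach d lam rho (n + 1) u = P d lam rho {ω | ∃ i, (ω [], shift i ω) ∈
      {p : (ℝ × ℝ × ℝ) × Clocks d | (p.1.1 < u ∧ u - p.1.1 + p.1.2.1 < p.1.2.2) ∧
      (p.2 []).1 < u - p.1.1 + p.1.2.1 ∧
        BlueAt n (u - p.1.1 + p.1.2.1 - (p.2 []).1) p.2}} := by
    unfold reach
    congr 1
    ext ω
    simp only [BlueAt, mem_ofPred_eq, exists_and_left, and_assoc]
  rw [h1]
  refine (prob_exists_shift (clockLaw lam rho) hF).trans ?_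
  rw [← lintegral_clockLaw_red_blue hlam hrho u (measurable_anyOf (measurable_reach hlam hrho n))]
  refine lintegral_congr fun c => ?_
  by_cases h : c.1 < u ∧ u - c.1 + c.2.1 < c.2.2
  · simp only [mem_ofPred_eq, h, true_and, if_true, and_self]
    rfl
  · simp [h]

lemma reach_zero (hlam : 0 < lam) (hrho : 0 < rho) (u : ℝ) :
    reach d lam rho 0 u = redOp lam (blueOp rho fun _ => 1) u := by
  have hS : MeasurableSet {c : ℝ × ℝ × ℝ | c.1 < u ∧ u - c.1 + c.2.1 < c.2.2} :=
    measurableSet_and (measurableSet_lt (by fun_prop) (by fun_prop))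
      (measurableSet_lt (by fun_prop) (by fun_prop))
  rw [← lintegral_clockLaw_red_blue hlam hrho u measurable_const]
  refine ((map_root hlam hrho).measure_preimage hS.nullMeasurableSet).trans ?_
  rw [← lintegral_indicator_one hS]
  refine lintegral_congr fun c => ?_
  simp only [indicator_apply, mem_ofPred_eq, Pi.one_apply]

lemma ae_nonneg (hlam : 0 < lam) (hrho : 0 < rho) : ∀ᵐ ω ∂P d lam rho, Nonneg ω := by
  have := isProbabilityMeasure_expMeasure hlam
  have := isProbabilityMeasure_expMeasure hrho
  have := isProbabilityMeasure_expMeasure one_pos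
  have := isProbabilityMeasure_clockLaw hlam hrho
  have h : ∀ᵐ c ∂clockLaw lam rho, 0 ≤ c.1 ∧ 0 ≤ c.2.1 ∧ 0 ≤ c.2.2 := by
    have h1 : ∀ᵐ c ∂clockLaw lam rho, 0 ≤ c.1 :=
      Measure.quasiMeasurePreserving_fst.ae ae_nonneg_expMeasure
    have h2 : ∀ᵐ c ∂(expMeasure 1).prod (expMeasure rho), 0 ≤ c.1 ∧ 0 ≤ c.2 := by
      filter_upwards [Measure.quasiMeasurePreserving_fst.ae ae_nonneg_expMeasure,
        Measure.quasiMeasurePreserving_snd.ae ae_nonneg_expMeasure] with c hc1 hc2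
      exact ⟨hc1, hc2⟩
    have h3 : ∀ᵐ c ∂clockLaw lam rho, 0 ≤ c.2.1 ∧ 0 ≤ c.2.2 :=
      Measure.quasiMeasurePreserving_snd.ae h2
    filter_upwards [h1, h3] with c hc1 hc2
    exact ⟨hc1, hc2⟩
  unfold Nonneg
  rw [ae_all_iff]
  intro v
  exact (measurePreserving_eval_infinitePi (fun _ : Vertex d => clockLaw lam rho)
    v).quasiMeasurePreserving.ae h

lemma prob_eventB (hlam : 0 < lam) (hrho : 0 < rho) :
    P d lam rho (eventB d) = ⨅ n, P d lam rho {ω | BlueAt n 0 ω} := by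
  have := isProbabilityMeasure_P (d := d) hlam hrho
  have h1 : eventB d =ᵐ[P d lam rho] ⋂ n, {ω | BlueAt n 0 ω} := by
    filter_upwards [ae_nonneg (d := d) hlam hrho] with ω hω
    have := mem_eventB_iff hω
    apply propext
    refine this.trans ?_
    exact mem_iInter.symm
  have hmeas : ∀ n, MeasurableSet {ω : Clocks d | BlueAt n 0 ω} := fun n =>
    (measurable_prodMk_left (x := (0 : ℝ))) (measurableSet_blueAt n)
  rw [measure_congr h1]
  exact (antitone_nat_of_succ_le fun n ω (h : BlueAt (n + 1) 0 ω) => h.mono).measure_iInter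
    (fun n => (hmeas n).nullMeasurableSet) ⟨0, measure_ne_top _ _⟩

lemma prob_eventA_le (n : ℕ) : P d lam rho (eventA d) ≤ P d lam rho {ω | RedAt n ω} :=
  measure_mono fun _ h => redAt_of_mem_eventA h n

lemma prob_redAt_of_red (hlam : 0 < lam) (hrho : 0 < rho) (n : ℕ) (x : ℝ) :
    P d lam rho {ω | (ω []).1 < x ∧ RedAt n ω} =
      expMeasure lam (Iio x) * P d lam rho {ω | RedAt n ω} := by
  have := isProbabilityMeasure_expMeasure hlam
  have := isProbabilityMeasure_expMeasure hrho
  have := isProbabilityMeasure_expMeasure one_pos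
  have := isProbabilityMeasure_clockLaw hlam hrho
  have := isProbabilityMeasure_P (d := d) hlam hrho
  cases n with
  | zero =>
    simp only [RedAt, and_true, ofPred_true, measure_univ, mul_one]
    have hS : MeasurableSet {c : ℝ × ℝ × ℝ | c.1 < x} :=
      measurableSet_lt (by fun_prop) (by fun_prop)
    refine ((map_root hlam hrho).measure_preimage hS.nullMeasurableSet).trans ?_
    have : {c : ℝ × ℝ × ℝ | c.1 < x} = Iio x ×ˢ univ := by ext; simp
    rw [this, clockLaw, Measure.prod_prod]
    simp
  | succ n =>
    have hG : MeasurableSet {p : (ℝ × ℝ × ℝ) × Clocks d |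
        (p.2 []).1 < p.1.2.2 ∧ RedAt n p.2} := by
      have hroot : Measurable fun p : (ℝ × ℝ × ℝ) × Clocks d => p.2 [] :=
        (measurable_pi_apply []).comp measurable_snd
      exact measurableSet_and (measurableSet_lt (by fun_prop) (by fun_prop))
        (measurable_snd (measurableSet_redAt n))
    have hF : MeasurableSet {p : (ℝ × ℝ × ℝ) × Clocks d |
        p.1.1 < x ∧ (p.2 []).1 < p.1.2.2 ∧ RedAt n p.2} :=
      measurableSet_and (measurableSet_lt (by fun_prop) (by fun_prop)) hG
    have h1 : {ω : Clocks d | (ω []).1 < x ∧ RedAt (n + 1) ω} = {ω | ∃ i, (ω [], shift i ω) ∈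
        {p : (ℝ × ℝ × ℝ) × Clocks d | p.1.1 < x ∧ (p.2 []).1 < p.1.2.2 ∧ RedAt n p.2}} := by
      ext ω
      simp only [RedAt, mem_ofPred_eq, exists_and_left]
    have h2 := prob_exists_shift (clockLaw lam rho) hG
    have h3 := prob_exists_shift (clockLaw lam rho) hF
    rw [h1]
    refine h3.trans ?_
    refine Eq.trans ?_ (congrArg (expMeasure lam (Iio x) * ·) h2.symm)
    let k : ℝ → ℝ≥0∞ := fun D => anyOf d (P d lam rho {ω | (ω []).1 < D ∧ RedAt n ω})
    have hk : Measurable k := by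
      refine measurable_anyOf (measurable_measure_prodMk_left
        (s := {p : ℝ × Clocks d | (p.2 []).1 < p.1 ∧ RedAt n p.2}) ?_)
      have hroot : Measurable fun p : ℝ × Clocks d => p.2 [] :=
        (measurable_pi_apply []).comp measurable_snd
      exact measurableSet_and (measurableSet_lt (by fun_prop) (by fun_prop))
        (measurable_snd (measurableSet_redAt n))
    have h4 : ∀ c : ℝ × ℝ × ℝ, anyOf d ((Measure.infinitePi fun _ : Vertex d => clockLaw lam rho)
        {ω | (c, ω) ∈ {p : (ℝ × ℝ × ℝ) × Clocks d |
          p.1.1 < x ∧ (p.2 []).1 < p.1.2.2 ∧ RedAt n p.2}}) =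
        (Iio x).indicator 1 c.1 * k c.2.2 := by
      intro c
      by_cases hc : c.1 < x
      · simp only [mem_ofPred_eq, hc, true_and, indicator_of_mem (mem_Iio.2 hc), Pi.one_apply,
          one_mul]
        rfl
      · simp [hc]
    simp only [h4]
    change _ = expMeasure lam (Iio x) * ∫⁻ c : ℝ × ℝ × ℝ, k c.2.2 ∂clockLaw lam rho
    rw [clockLaw, lintegral_prod_mul (g := fun c : ℝ × ℝ => k c.2)
      (measurable_one.indicator measurableSet_Iio).aemeasurable (by fun_prop),
      lintegral_indicator_one measurableSet_Iio,
      lintegral_prod _ (by fun_prop : Measurable fun c : ℝ × ℝ × ℝ => k c.2.2).aemeasurable]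
    simp

lemma prob_redAt_succ (hlam : 0 < lam) (hrho : 0 < rho) (n : ℕ) :
    P d lam rho {ω | RedAt (n + 1) ω} = ∫⁻ x, anyOf d
      (expMeasure lam (Iio x) * P d lam rho {ω | RedAt n ω}) ∂expMeasure rho := by
  have := isProbabilityMeasure_expMeasure hlam
  have := isProbabilityMeasure_expMeasure hrho
  have := isProbabilityMeasure_expMeasure one_pos
  have := isProbabilityMeasure_clockLaw hlam hrho
  have hG : MeasurableSet {p : (ℝ × ℝ × ℝ) × Clocks d |
      (p.2 []).1 < p.1.2.2 ∧ RedAt n p.2} := by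
    have hroot : Measurable fun p : (ℝ × ℝ × ℝ) × Clocks d => p.2 [] :=
      (measurable_pi_apply []).comp measurable_snd
    exact measurableSet_and (measurableSet_lt (by fun_prop) (by fun_prop))
      (measurable_snd (measurableSet_redAt n))
  refine (prob_exists_shift (clockLaw lam rho) hG).trans ?_
  have h4 : ∀ c : ℝ × ℝ × ℝ, (Measure.infinitePi fun _ : Vertex d => clockLaw lam rho)
      {ω | (c, ω) ∈ {p : (ℝ × ℝ × ℝ) × Clocks d | (p.2 []).1 < p.1.2.2 ∧ RedAt n p.2}} =
      expMeasure lam (Iio c.2.2) * P d lam rho {ω | RedAt n ω} := fun c =>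
    prob_redAt_of_red hlam hrho n c.2.2
  simp only [h4]
  have hmeas_Iio := measurable_expMeasure_Iio (lam := lam)
  have hk : Measurable fun x => anyOf d
      (expMeasure lam (Iio x) * P d lam rho {ω | RedAt n ω}) :=
    measurable_anyOf (hmeas_Iio.mul_const _)
  have h5 : Measurable fun c : ℝ × ℝ => anyOf d
      (expMeasure lam (Iio c.2) * P d lam rho {ω | RedAt n ω}) := hk.comp measurable_snd
  have h6 : Measurable fun c : ℝ × ℝ × ℝ => anyOf d
      (expMeasure lam (Iio c.2.2) * P d lam rho {ω | RedAt n ω}) := h5.comp measurable_snd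
  rw [clockLaw, lintegral_prod _ h6.aemeasurable]
  simp only [lintegral_const, measure_univ, mul_one]
  rw [lintegral_prod _ h5.aemeasurable]
  simp

lemma le_prob_eventA (hlam : 0 < lam) (hrho : 0 < rho) {q : ℝ≥0∞}
    (hq : ∀ n, q ≤ P d lam rho {ω | RedAt n ω}) :
    ∫⁻ c, (if c.2.2 < c.2.1 then anyOf d (expMeasure lam (Iio c.2.2) * q) else 0)
      ∂clockLaw lam rho ≤ P d lam rho (eventA d) := by
  have := isProbabilityMeasure_clockLaw hlam hrho
  have := isProbabilityMeasure_P (d := d) hlam hrho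
  let F : ℕ → Set ((ℝ × ℝ × ℝ) × Clocks d) := fun n =>
    {p | p.1.2.2 < p.1.2.1 ∧ (p.2 []).1 < p.1.2.2 ∧ RedAt n p.2}
  have hF : ∀ n, MeasurableSet (F n) := by
    intro n
    have hroot : Measurable fun p : (ℝ × ℝ × ℝ) × Clocks d => p.2 [] :=
      (measurable_pi_apply []).comp measurable_snd
    exact measurableSet_and (measurableSet_lt (by fun_prop) (by fun_prop))
      (measurableSet_and (measurableSet_lt (by fun_prop) (by fun_prop))
        (measurable_snd (measurableSet_redAt n)))
  let E : ℕ → Set (Clocks d) := fun n => {ω | ∃ i, (ω [], shift i ω) ∈ F n}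
  have hE : ∀ n, MeasurableSet (E n) := by
    intro n
    simp only [E, ofPred_exists]
    refine MeasurableSet.iUnion fun i => ?_
    exact ((measurable_pi_apply []).prodMk (measurable_shift i)) (hF n)
  have hanti : Antitone E := antitone_nat_of_succ_le fun n ω h => by
    obtain ⟨i, h1, h2, h3⟩ := h
    exact ⟨i, h1, h2, h3.mono⟩
  have h1 : ⋂ n, E n ≤ᵐ[P d lam rho] eventA d := by
    filter_upwards [ae_nonneg (d := d) hlam hrho] with ω hω h
    exact mem_eventA_of_root_dead hω (mem_iInter.1 h)
  refine le_trans ?_ (measure_mono_ae h1)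
  rw [hanti.measure_iInter (fun n => (hE n).nullMeasurableSet) ⟨0, measure_ne_top _ _⟩]
  refine le_iInf fun n => ?_
  refine le_trans ?_ (prob_exists_shift (clockLaw lam rho) (hF n)).ge
  refine lintegral_mono fun c => ?_
  split_ifs with hc
  · have h2 : (Measure.infinitePi fun _ : Vertex d => clockLaw lam rho) {ω | (c, ω) ∈ F n} =
        expMeasure lam (Iio c.2.2) * P d lam rho {ω | RedAt n ω} := by
      rw [← prob_redAt_of_red hlam hrho n]
      simp only [F, mem_ofPred_eq, hc, true_and]
      rfl
    rw [h2]
    unfold anyOf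
    gcongr
    exact hq n
  · exact bot_le

end recursions

/-! ### The function `anyOf` -/

section anyOf

variable {d : ℕ}

lemma anyOf_mono {x y : ℝ≥0∞} (h : x ≤ y) : anyOf d x ≤ anyOf d y := by
  unfold anyOf
  gcongr

lemma anyOf_ofReal {x : ℝ} (h0 : 0 ≤ x) (h1 : x ≤ 1) :
    anyOf d (ENNReal.ofReal x) = ENNReal.ofReal (1 - (1 - x) ^ d) := by
  rw [anyOf, ENNReal.ofReal_sub _ (pow_nonneg (sub_nonneg.2 h1) _), ENNReal.ofReal_pow (by linarith),
    ENNReal.ofReal_sub _ h0, ENNReal.ofReal_one]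

lemma exists_ofReal_of_le_one {y : ℝ≥0∞} (hy : y ≤ 1) :
    ∃ x : ℝ, 0 ≤ x ∧ x ≤ 1 ∧ y = ENNReal.ofReal x :=
  ⟨y.toReal, ENNReal.toReal_nonneg, ENNReal.toReal_le_of_le_ofReal one_pos.le (by simpa using hy),
    (ENNReal.ofReal_toReal (ne_top_of_le_ne_top ENNReal.one_ne_top hy)).symm⟩

lemma anyOf_le_mul {y : ℝ≥0∞} (hy : y ≤ 1) : anyOf d y ≤ d * y := by
  obtain ⟨x, h0, h1, rfl⟩ := exists_ofReal_of_le_one hy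
  rw [anyOf_ofReal h0 h1, ← ENNReal.ofReal_natCast, ← ENNReal.ofReal_mul (Nat.cast_nonneg d)]
  refine ENNReal.ofReal_le_ofReal ?_
  have := one_add_mul_le_pow (show (-2 : ℝ) ≤ -x by linarith) d
  rw [← sub_eq_add_neg] at this
  linarith

lemma anyOf_lt_mul (hd : 2 ≤ d) {y : ℝ≥0∞} (hy : y ≤ 1) (h : y ≠ 0) : anyOf d y < d * y := by
  obtain ⟨x, h0, h1, rfl⟩ := exists_ofReal_of_le_one hy
  have hx : 0 < x := by
    rcases h0.eq_or_lt with rfl | hx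
    · simp at h
    · exact hx
  have hd' : (0 : ℝ) < d := by exact_mod_cast (by omega : 0 < d)
  rw [anyOf_ofReal h0 h1, ← ENNReal.ofReal_natCast, ← ENNReal.ofReal_mul hd'.le]
  refine (ENNReal.ofReal_lt_ofReal_iff (by positivity)).2 ?_
  have := one_add_mul_self_lt_rpow_one_add (show (-1 : ℝ) ≤ -x by linarith) (by linarith)
    (show (1 : ℝ) < d by exact_mod_cast (by omega : 1 < d))
  rw [Real.rpow_natCast, ← sub_eq_add_neg] at this
  linarith

lemma anyOf_le_one (y : ℝ≥0∞) : anyOf d y ≤ 1 := tsub_le_self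

lemma pow_one_sub_le {x : ℝ} (h0 : 0 ≤ x) (h1 : x ≤ 1) (n : ℕ) :
    (1 - x) ^ n ≤ 1 - n * x + (n * x) ^ 2 := by
  induction n with
  | zero => simp
  | succ n ih =>
    rw [pow_succ]
    have h2 := mul_le_mul_of_nonneg_right ih (sub_nonneg.2 h1)
    refine h2.trans ?_
    push_cast
    have h3 : 0 ≤ (n : ℝ) := Nat.cast_nonneg n
    have h4 : 0 ≤ (n : ℝ) ^ 2 * x ^ 3 := by positivity
    have h5 : 0 ≤ (n : ℝ) * x ^ 2 := by positivity
    nlinarith [sq_nonneg x]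

lemma le_anyOf {y : ℝ≥0∞} {η : ℝ} (h0 : 0 ≤ η) (h1 : η ≤ 1) (hy : y ≤ ENNReal.ofReal η) :
    ENNReal.ofReal (1 - d * η) * (d * y) ≤ anyOf d y := by
  obtain ⟨x, hx0, hx1, rfl⟩ := exists_ofReal_of_le_one
    (hy.trans (by simpa using ENNReal.ofReal_le_ofReal h1))
  have hxη : x ≤ η := (ENNReal.ofReal_le_ofReal_iff h0).1 hy
  rw [anyOf_ofReal hx0 hx1, ← ENNReal.ofReal_natCast, ← ENNReal.ofReal_mul (Nat.cast_nonneg d),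
    ← ENNReal.ofReal_mul' (by positivity)]
  refine ENNReal.ofReal_le_ofReal ?_
  have h2 := pow_one_sub_le hx0 hx1 d
  have h3 : 0 ≤ (d : ℝ) := Nat.cast_nonneg d
  have h4 : (d * x) * (d * x) ≤ (d * η) * (d * x) := by gcongr
  nlinarith

lemma anyOf_eq_zero_iff (hd : d ≠ 0) {y : ℝ≥0∞} : anyOf d y = 0 ↔ y = 0 := by
  constructor
  · intro h
    by_contra hy
    have h1 : (1 - y) ^ d < 1 := by
      refine pow_lt_one₀ bot_le ?_ hd
      exact ENNReal.sub_lt_self ENNReal.one_ne_top one_ne_zero hy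
    exact (tsub_pos_of_lt h1).ne' h
  · rintro rfl
    simp

lemma continuous_anyOf : Continuous (anyOf d) := by
  unfold anyOf
  have h1 : Continuous fun y : ℝ≥0∞ => 1 - y := ENNReal.continuous_sub_left ENNReal.one_ne_top
  exact h1.comp ((ENNReal.continuous_pow d).comp h1)

end anyOf

/-! ### Integrals of derivatives -/

lemma lintegral_Ioi_of_hasDerivAt {g g' : ℝ → ℝ} {a l : ℝ}
    (hderiv : ∀ x ∈ Ici a, HasDerivAt g (g' x) x) (hpos : ∀ x ∈ Ioi a, 0 ≤ g' x)
    (hl : Filter.Tendsto g Filter.atTop (nhds l)) :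
    ∫⁻ x in Ioi a, ENNReal.ofReal (g' x) = ENNReal.ofReal (l - g a) := by
  rw [← integral_Ioi_of_hasDerivAt_of_nonneg' hderiv hpos hl,
    ofReal_integral_eq_lintegral_ofReal (integrableOn_Ioi_deriv_of_nonneg' hderiv hpos hl)]
  exact (ae_restrict_iff' measurableSet_Ioi).2 (ae_of_all _ hpos)

lemma lintegral_Ioo_of_hasDerivAt {g g' : ℝ → ℝ} {a b : ℝ} (hab : a ≤ b)
    (hderiv : ∀ x, HasDerivAt g (g' x) x) (hcont : Continuous g')
    (hpos : ∀ x ∈ Ioo a b, 0 ≤ g' x) :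
    ∫⁻ x in Ioo a b, ENNReal.ofReal (g' x) = ENNReal.ofReal (g b - g a) := by
  have h1 := intervalIntegral.integral_eq_sub_of_hasDerivAt (fun x _ => hderiv x)
    (hcont.intervalIntegrable a b)
  rw [← h1, intervalIntegral.integral_of_le hab, setIntegral_congr_set Ioo_ae_eq_Ioc.symm,
    ofReal_integral_eq_lintegral_ofReal
      ((hcont.integrableOn_Icc (a := a) (b := b)).mono_set Ioo_subset_Icc_self)]
  exact (ae_restrict_iff' measurableSet_Ioo).2 (ae_of_all _ hpos)

lemma tendsto_exp_neg_mul {a : ℝ} (ha : 0 < a) (c : ℝ) :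
    Filter.Tendsto (fun x => c * Real.exp (-(a * x))) Filter.atTop (nhds 0) := by
  have h := (Real.tendsto_exp_neg_atTop_nhds_zero.comp
    (Filter.tendsto_id.const_mul_atTop ha)).const_mul c
  simpa using h

lemma hasDerivAt_exp_neg_mul (a c x : ℝ) :
    HasDerivAt (fun x => c * Real.exp (-(a * x))) (c * (Real.exp (-(a * x)) * -a)) x := by
  have h : HasDerivAt (fun x : ℝ => -(a * x)) (-a) x := by
    simpa using (hasDerivAt_id x).const_mul (-a)
  exact (h.exp).const_mul c

/-! ### Red without blue -/

lemma lintegral_expMeasure_Iio {lam rho : ℝ} (hlam : 0 < lam) (hrho : 0 < rho) :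
    ∫⁻ x, expMeasure lam (Iio x) ∂expMeasure rho = ENNReal.ofReal (lam / (lam + rho)) := by
  have hmeas := measurable_expMeasure_Iio (lam := lam)
  rw [lintegral_expMeasure hmeas]
  have h1 : ∫⁻ x in Ioi 0, ENNReal.ofReal (rho * Real.exp (-(rho * x))) * expMeasure lam (Iio x) =
      ∫⁻ x in Ioi 0, ENNReal.ofReal (-1 * (Real.exp (-(rho * x)) * -rho) +
        rho / (lam + rho) * (Real.exp (-((lam + rho) * x)) * -(lam + rho))) := by
    refine setLIntegral_congr_fun measurableSet_Ioi fun x hx => ?_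
    rw [expMeasure_Iio hlam (le_of_lt hx), ← ENNReal.ofReal_mul (by positivity)]
    congr 1
    have : Real.exp (-((lam + rho) * x)) = Real.exp (-(lam * x)) * Real.exp (-(rho * x)) := by
      rw [← Real.exp_add]
      congr 1
      ring
    rw [this]
    field_simp
    ring
  rw [h1, lintegral_Ioi_of_hasDerivAt (l := 0 + 0)
    (fun x _ => (hasDerivAt_exp_neg_mul rho (-1) x).add (hasDerivAt_exp_neg_mul (lam + rho) _ x))]
  · congr 1
    simp
    field_simp
    ring
  · intro x hx
    have h2 : Real.exp (-((lam + rho) * x)) ≤ Real.exp (-(rho * x)) :=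
      Real.exp_le_exp.2 (by nlinarith [mem_Ioi.1 hx])
    have h3 : rho / (lam + rho) * (Real.exp (-((lam + rho) * x)) * -(lam + rho)) =
        - (rho * Real.exp (-((lam + rho) * x))) := by field_simp
    rw [h3]
    nlinarith
  · exact (tendsto_exp_neg_mul hrho _).add (tendsto_exp_neg_mul (by positivity) _)

/-- Without blue, the red vertices form a branching process with mean offspring
`d * lam / (lam + rho) = 1`, which dies out. -/
lemma prob_eventA_critical {d : ℕ} (hd : 2 ≤ d) {lam : ℝ} (hlam : 0 < lam) :
    P d lam (lam * ((d : ℝ) - 1)) (eventA d) = 0 := by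
  have hd2 : (2 : ℝ) ≤ d := by exact_mod_cast hd
  have hrho : 0 < lam * ((d : ℝ) - 1) := mul_pos hlam (by linarith)
  set rho := lam * ((d : ℝ) - 1) with hrho_def
  have := isProbabilityMeasure_P (d := d) hlam hrho
  have := isProbabilityMeasure_expMeasure hlam
  have := isProbabilityMeasure_expMeasure hrho
  let p : ℕ → ℝ≥0∞ := fun n => P d lam rho {ω | RedAt n ω}
  have hp : Antitone p := antitone_nat_of_succ_le fun n =>
    measure_mono fun ω (h : RedAt (n + 1) ω) => h.mono
  have hmeas := measurable_expMeasure_Iio (lam := lam)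
  have hp1 : ∀ n, p n ≤ 1 := fun n => prob_le_one
  set q : ℝ≥0∞ := ⨅ n, p n with hq
  have hq1 : q ≤ 1 := (iInf_le _ 0).trans (hp1 0)
  have hlim : Filter.Tendsto p Filter.atTop (nhds q) := tendsto_atTop_iInf hp
  have hfix : q = ∫⁻ x, anyOf d (expMeasure lam (Iio x) * q) ∂expMeasure rho := by
    have h1 : Filter.Tendsto (fun n => ∫⁻ x, anyOf d (expMeasure lam (Iio x) * p n)
        ∂expMeasure rho) Filter.atTop
        (nhds (∫⁻ x, anyOf d (expMeasure lam (Iio x) * q) ∂expMeasure rho)) := by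
      refine tendsto_lintegral_of_dominated_convergence (fun _ => 1)
        (fun n => measurable_anyOf (hmeas.mul_const _))
        (fun n => ae_of_all _ fun x => anyOf_le_one _) (by simp) (ae_of_all _ fun x => ?_)
      exact (continuous_anyOf.tendsto _).comp
        (ENNReal.Tendsto.const_mul hlim (Or.inr (measure_ne_top _ _)))
    have h2 : Filter.Tendsto (fun n => p (n + 1)) Filter.atTop (nhds q) :=
      hlim.comp (Filter.tendsto_add_atTop_nat 1)
    refine tendsto_nhds_unique h2 (h1.congr fun n => ?_)
    exact (prob_redAt_succ hlam hrho n).symm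
  have hq0 : q = 0 := by
    by_contra hne
    have h1 : ∫⁻ x, d * (expMeasure lam (Iio x) * q) ∂expMeasure rho = q := by
      rw [lintegral_const_mul _ (hmeas.mul_const _), lintegral_mul_const _ hmeas,
        lintegral_expMeasure_Iio hlam hrho, ← mul_assoc, ← ENNReal.ofReal_natCast,
        ← ENNReal.ofReal_mul (by positivity)]
      have : (d : ℝ) * (lam / (lam + rho)) = 1 := by
        have h2 : lam + rho = d * lam := by
          rw [hrho_def]
          ring
        rw [h2]
        field_simp
      rw [this, ENNReal.ofReal_one, one_mul]
    have hpos : ∀ᵐ x ∂expMeasure rho, 0 < x := by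
      have h2 : expMeasure rho {0} = 0 := by
        rw [expMeasure, gammaMeasure]
        exact withDensity_absolutelyContinuous _ _ (by simp)
      have h3 : ∀ᵐ x ∂expMeasure rho, x ≠ 0 := by
        rw [ae_iff]
        simpa using h2
      filter_upwards [h3, ae_nonneg_expMeasure] with x h4 h5
      exact lt_of_le_of_ne h5 (Ne.symm h4)
    have h2 : ∫⁻ x, anyOf d (expMeasure lam (Iio x) * q) ∂expMeasure rho <
        ∫⁻ x, d * (expMeasure lam (Iio x) * q) ∂expMeasure rho := by
      refine lintegral_strict_mono (IsProbabilityMeasure.ne_zero _)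
        ((hmeas.mul_const _).const_mul _).aemeasurable ?_ ?_
      · rw [← hfix]
        exact ne_top_of_le_ne_top ENNReal.one_ne_top hq1
      · filter_upwards [hpos] with x hx
        refine anyOf_lt_mul hd (mul_le_one' prob_le_one hq1) (mul_ne_zero ?_ hne)
        rw [expMeasure_Iio hlam hx.le]
        have : Real.exp (-(lam * x)) < 1 := Real.exp_lt_one_iff.2 (by nlinarith)
        exact (ENNReal.ofReal_pos.2 (by linarith)).ne'
    rw [h1, ← hfix] at h2
    exact lt_irrefl _ h2
  rw [← nonpos_iff_eq_zero, ← hq0]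
  exact le_iInf fun n => prob_eventA_le n

lemma expMeasure_Ioc_pos {r : ℝ} (hr : 0 < r) : 0 < expMeasure r (Ioc 1 2) := by
  rw [pos_iff_ne_zero]
  intro h
  have h1 : expMeasure r (Ioi 1) ≤ expMeasure r (Ioi 2) := by
    rw [← Ioc_union_Ioi_eq_Ioi (by norm_num : (1 : ℝ) ≤ 2)]
    refine (measure_union_le _ _).trans ?_
    rw [h, zero_add]
  rw [expMeasure_Ioi hr (by norm_num), expMeasure_Ioi hr (by norm_num),
    ENNReal.ofReal_le_ofReal_iff (Real.exp_nonneg _), Real.exp_le_exp] at h1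
  linarith

lemma prob_eventA_pos {d : ℕ} (hd : 2 ≤ d) {lam rho : ℝ} (hlam : 0 < lam) (hrho : 0 < rho)
    (h : rho < lam * ((d : ℝ) - 1)) : 0 < P d lam rho (eventA d) := by
  have hd2 : (2 : ℝ) ≤ d := by exact_mod_cast hd
  have hd0 : (0 : ℝ) < d := by linarith
  have := isProbabilityMeasure_P (d := d) hlam hrho
  have := isProbabilityMeasure_expMeasure hlam
  have := isProbabilityMeasure_expMeasure hrho
  have := isProbabilityMeasure_expMeasure one_pos
  have hmeas := measurable_expMeasure_Iio (lam := lam)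
  -- `η` solves `(1 - d * η) * (d * lam / (lam + rho)) = 1`
  let η : ℝ := (1 - (lam + rho) / (d * lam)) / d
  have hlt : (lam + rho) / (d * lam) < 1 := by
    rw [div_lt_one (by positivity)]
    nlinarith
  have hη0 : 0 < η := div_pos (by linarith) hd0
  have hη1 : η ≤ 1 := by
    rw [div_le_one hd0]
    have : 0 < (lam + rho) / (d * lam) := by positivity
    linarith
  have hη : 1 - d * η = (lam + rho) / (d * lam) := by
    simp only [η]
    field_simp
    ring
  have hq : ∀ n, ENNReal.ofReal η ≤ P d lam rho {ω | RedAt n ω} := by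
    intro n
    induction n with
    | zero => simpa [RedAt] using hη1
    | succ n ih =>
      rw [prob_redAt_succ hlam hrho]
      calc ENNReal.ofReal η
          = ∫⁻ x, ENNReal.ofReal (1 - d * η) * (d * (expMeasure lam (Iio x) * ENNReal.ofReal η))
              ∂expMeasure rho := by
            rw [lintegral_const_mul _ ((hmeas.mul_const _).const_mul _),
              lintegral_const_mul _ (hmeas.mul_const _), lintegral_mul_const _ hmeas,
              lintegral_expMeasure_Iio hlam hrho, hη, ← ENNReal.ofReal_natCast,
              ← ENNReal.ofReal_mul (by positivity), ← ENNReal.ofReal_mul (by positivity),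
              ← ENNReal.ofReal_mul (by positivity)]
            congr 1
            field_simp
        _ ≤ ∫⁻ x, anyOf d (expMeasure lam (Iio x) * P d lam rho {ω | RedAt n ω})
              ∂expMeasure rho := by
            refine lintegral_mono fun x => ?_
            refine (le_anyOf hη0.le hη1 (mul_le_of_le_one_left bot_le prob_le_one)).trans ?_
            exact anyOf_mono (mul_le_mul_right ih _)
  refine lt_of_lt_of_le ?_ (le_prob_eventA hlam hrho hq)
  have hm : Measurable fun c : ℝ × ℝ × ℝ => if c.2.2 < c.2.1 then
      anyOf d (expMeasure lam (Iio c.2.2) * ENNReal.ofReal η) else 0 := by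
    refine Measurable.ite (measurableSet_lt (by fun_prop) (by fun_prop)) ?_ measurable_const
    have h1 : Measurable fun x => anyOf d (expMeasure lam (Iio x) * ENNReal.ofReal η) :=
      measurable_anyOf (hmeas.mul_const _)
    exact h1.comp (measurable_snd.comp measurable_snd)
  rw [lintegral_pos_iff_support hm]
  have hset : 0 < clockLaw lam rho (univ ×ˢ (Ioi 2 ×ˢ Ioc 1 2)) := by
    rw [clockLaw, Measure.prod_prod, Measure.prod_prod, measure_univ, one_mul]
    refine ENNReal.mul_pos ?_ (expMeasure_Ioc_pos hrho).ne'
    rw [expMeasure_Ioi one_pos (by norm_num)]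
    exact (ENNReal.ofReal_pos.2 (Real.exp_pos _)).ne'
  refine hset.trans_le (measure_mono ?_)
  rintro ⟨R, W, D⟩ ⟨-, hW, hD⟩
  simp only [mem_Ioi, mem_Ioc] at hW hD
  have hlt : D < W := lt_of_le_of_lt hD.2 hW
  simp only [Function.mem_support, hlt, if_true]
  rw [Ne, anyOf_eq_zero_iff (by omega), expMeasure_Iio hlam (by linarith)]
  have : Real.exp (-(lam * D)) < 1 := Real.exp_lt_one_iff.2 (by nlinarith)
  exact mul_ne_zero (ENNReal.ofReal_pos.2 (by linarith)).ne' (ENNReal.ofReal_pos.2 hη0).ne'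

/-! ### Properties of the operators -/

section operators

variable {lam rho : ℝ}

/-- The operator of one generation: the weight of an edge in terms of the weights `g` of the edges
to the children. -/
noncomputable def genOp (lam rho : ℝ) (g : ℝ → ℝ≥0∞) : ℝ → ℝ≥0∞ := redOp lam (blueOp rho g)

lemma blueOp_mono {g g' : ℝ → ℝ≥0∞} {t : ℝ} (h : ∀ z, t < z → g z ≤ g' z) :
    blueOp rho g t ≤ blueOp rho g' t :=
  setLIntegral_mono' measurableSet_Ioi fun z hz => mul_le_mul_right (h z hz) _

lemma redOp_mono {g g' : ℝ → ℝ≥0∞} {u : ℝ} (h : ∀ x, 0 < x → x < u → g x ≤ g' x) :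
    redOp lam g u ≤ redOp lam g' u :=
  setLIntegral_mono' measurableSet_Ioo fun x hx => mul_le_mul_right (h x hx.1 hx.2) _

lemma genOp_mono {g g' : ℝ → ℝ≥0∞} (h : ∀ z, 0 < z → g z ≤ g' z) (u : ℝ) :
    genOp lam rho g u ≤ genOp lam rho g' u :=
  redOp_mono fun _ hx _ => blueOp_mono fun z hz => h z (hx.trans hz)

lemma blueOp_const_mul (c : ℝ≥0∞) {g : ℝ → ℝ≥0∞} (hg : Measurable g) (t : ℝ) :
    blueOp rho (fun z => c * g z) t = c * blueOp rho g t := by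
  unfold blueOp
  rw [← lintegral_const_mul _ (by fun_prop)]
  exact lintegral_congr fun z => by ring

lemma redOp_const_mul (c : ℝ≥0∞) {g : ℝ → ℝ≥0∞} (hg : Measurable g) (u : ℝ) :
    redOp lam (fun z => c * g z) u = c * redOp lam g u := by
  unfold redOp
  rw [← lintegral_const_mul _ (by fun_prop)]
  exact lintegral_congr fun z => by ring

lemma genOp_const_mul (c : ℝ≥0∞) {g : ℝ → ℝ≥0∞} (hg : Measurable g) (u : ℝ) :
    genOp lam rho (fun z => c * g z) u = c * genOp lam rho g u := by
  unfold genOp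
  rw [← redOp_const_mul c (measurable_blueOp rho hg)]
  congr 1
  funext t
  exact blueOp_const_mul c hg t

lemma blueOp_add {g g' : ℝ → ℝ≥0∞} (hg : Measurable g) (t : ℝ) :
    blueOp rho (fun z => g z + g' z) t = blueOp rho g t + blueOp rho g' t := by
  unfold blueOp
  rw [← lintegral_add_left (by fun_prop)]
  exact lintegral_congr fun z => by ring

lemma redOp_add {g g' : ℝ → ℝ≥0∞} (hg : Measurable g) (u : ℝ) :
    redOp lam (fun z => g z + g' z) u = redOp lam g u + redOp lam g' u := by
  unfold redOp
  rw [← lintegral_add_left (by fun_prop)]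
  exact lintegral_congr fun z => by ring

lemma genOp_add {g g' : ℝ → ℝ≥0∞} (hg : Measurable g) (u : ℝ) :
    genOp lam rho (fun z => g z + g' z) u = genOp lam rho g u + genOp lam rho g' u := by
  unfold genOp
  rw [← redOp_add (measurable_blueOp rho hg)]
  congr 1
  funext t
  exact blueOp_add hg t

lemma measurable_genOp {g : ℝ → ℝ≥0∞} (hg : Measurable g) : Measurable (genOp lam rho g) :=
  measurable_redOp lam (measurable_blueOp rho hg)

lemma blueOp_exp {β : ℝ} (h : 0 < 1 + rho + β) (t : ℝ) :
    blueOp rho (fun z => ENNReal.ofReal (Real.exp (-(β * z)))) t =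
      ENNReal.ofReal (Real.exp (-((rho + β) * t)) / (1 + rho + β)) := by
  have h1 : blueOp rho (fun z => ENNReal.ofReal (Real.exp (-(β * z)))) t =
      ∫⁻ z in Ioi t, ENNReal.ofReal (-(Real.exp t / (1 + rho + β)) *
        (Real.exp (-((1 + rho + β) * z)) * -(1 + rho + β))) := by
    refine lintegral_congr fun z => ?_
    rw [← ENNReal.ofReal_mul (by positivity)]
    congr 1
    rw [← Real.exp_add, ← Real.exp_add]
    have : Real.exp (t - z + -(rho * z) + -(β * z)) =
        Real.exp t * Real.exp (-((1 + rho + β) * z)) := by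
      rw [← Real.exp_add]
      congr 1
      ring
    rw [this]
    field_simp
  rw [h1, lintegral_Ioi_of_hasDerivAt (fun x _ => hasDerivAt_exp_neg_mul (1 + rho + β) _ x) ?_
    (tendsto_exp_neg_mul h _)]
  · congr 1
    have : Real.exp (-((rho + β) * t)) = Real.exp t * Real.exp (-((1 + rho + β) * t)) := by
      rw [← Real.exp_add]
      congr 1
      ring
    rw [this]
    ring
  · intro x _
    have : -(Real.exp t / (1 + rho + β)) *
        (Real.exp (-((1 + rho + β) * x)) * -(1 + rho + β)) =
        Real.exp t * Real.exp (-((1 + rho + β) * x)) := by field_simp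
    rw [this]
    positivity

lemma redOp_exp (hlam : 0 < lam) {κ : ℝ} (hκ : κ ≠ lam) {u : ℝ} (hu : 0 ≤ u) :
    redOp lam (fun x => ENNReal.ofReal (Real.exp (-(κ * x)))) u =
      ENNReal.ofReal (lam / (lam - κ) * (Real.exp (-(κ * u)) - Real.exp (-(lam * u)))) := by
  have hne : κ - lam ≠ 0 := sub_ne_zero.2 hκ
  have hne' : lam - κ ≠ 0 := sub_ne_zero.2 hκ.symm
  have h0 : ∀ x, lam / (lam - κ) * Real.exp (-(lam * u)) *
      (Real.exp (-((κ - lam) * x)) * -(κ - lam)) =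
      lam * (Real.exp (-(lam * u)) * Real.exp (-((κ - lam) * x))) := by
    intro x
    field_simp
    ring
  have h1 : redOp lam (fun x => ENNReal.ofReal (Real.exp (-(κ * x)))) u =
      ∫⁻ x in Ioo 0 u, ENNReal.ofReal (lam / (lam - κ) * Real.exp (-(lam * u)) *
        (Real.exp (-((κ - lam) * x)) * -(κ - lam))) := by
    refine lintegral_congr fun x => ?_
    rw [← ENNReal.ofReal_mul (by positivity), h0]
    congr 1
    rw [mul_assoc, ← Real.exp_add, ← Real.exp_add]
    congr 2
    ring
  rw [h1, lintegral_Ioo_of_hasDerivAt hu (fun x => hasDerivAt_exp_neg_mul (κ - lam) _ x)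
    (by fun_prop)]
  · congr 1
    have : Real.exp (-(κ * u)) = Real.exp (-(lam * u)) * Real.exp (-((κ - lam) * u)) := by
      rw [← Real.exp_add]
      congr 1
      ring
    rw [this]
    simp only [mul_zero, neg_zero, Real.exp_zero]
    ring
  · intro x _
    rw [h0]
    positivity

lemma redOp_one (hlam : 0 < lam) {u : ℝ} (hu : 0 ≤ u) :
    redOp lam (fun _ => 1) u = ENNReal.ofReal (1 - Real.exp (-(lam * u))) := by
  have := redOp_exp hlam hlam.ne hu
  simpa [hlam.ne'] using this

lemma blueOp_one_le (hrho : 0 ≤ rho) {t : ℝ} (ht : 0 ≤ t) : blueOp rho (fun _ => 1) t ≤ 1 := by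
  have h := blueOp_exp (rho := rho) (β := 0) (by linarith) t
  simp only [zero_mul, neg_zero, Real.exp_zero, ENNReal.ofReal_one, add_zero] at h
  rw [h, ← ENNReal.ofReal_one]
  refine ENNReal.ofReal_le_ofReal ?_
  rw [div_le_one (by linarith)]
  have : Real.exp (-(rho * t)) ≤ 1 := Real.exp_le_one_iff.2 (by nlinarith)
  linarith

lemma redOp_one_le (hlam : 0 < lam) (u : ℝ) : redOp lam (fun _ => 1) u ≤ 1 := by
  rcases le_total 0 u with hu | hu
  · rw [redOp_one hlam hu, ← ENNReal.ofReal_one]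
    refine ENNReal.ofReal_le_ofReal ?_
    have := Real.exp_pos (-(lam * u))
    linarith
  · simp [redOp, Ioo_eq_empty (not_lt.2 hu)]

end operators

/-! ### Extinction of blue -/

section extinction

variable {d : ℕ} {lam rho : ℝ}

lemma reach_succ_le (hlam : 0 < lam) (hrho : 0 < rho) {n : ℕ} {c : ℝ≥0∞} {f : ℝ → ℝ≥0∞}
    (hf : Measurable f) (h : ∀ z, 0 < z → reach d lam rho n z ≤ c * f z) (u : ℝ) :
    reach d lam rho (n + 1) u ≤ d * c * genOp lam rho f u := by
  rw [reach_succ hlam hrho, ← genOp_const_mul _ hf]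
  refine genOp_mono (fun z hz => (anyOf_le_mul (reach_le_one hlam hrho n z)).trans ?_) u
  rw [mul_assoc]
  exact mul_le_mul_right (h z hz) _

/-- If the edge probabilities `reach` decay geometrically in `n`, uniformly up to a factor `f z`
with a finite mean, then blue does not survive. -/
lemma prob_eventB_eq_zero_of_reach_le (hlam : 0 < lam) (hrho : 0 < rho) {n₀ : ℕ} {c θ : ℝ}
    (hθ0 : 0 ≤ θ) (hθ : θ < 1) {f : ℝ → ℝ≥0∞} (hf : Measurable f) (hfin : blueOp rho f 0 ≠ ∞)
    (h : ∀ n z, 0 < z → reach d lam rho (n₀ + n) z ≤ ENNReal.ofReal (c * θ ^ n) * f z) :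
    P d lam rho (eventB d) = 0 := by
  rw [prob_eventB hlam hrho, ← nonpos_iff_eq_zero]
  have hle : ∀ n, ⨅ n, P d lam rho {ω | BlueAt n 0 ω} ≤
      d * ENNReal.ofReal (c * θ ^ n) * blueOp rho f 0 := by
    intro n
    refine (iInf_le _ (n₀ + n + 1)).trans ?_
    rw [prob_blueAt_succ hlam hrho _ le_rfl, ← blueOp_const_mul _ hf]
    refine blueOp_mono fun z hz => (anyOf_le_mul (reach_le_one hlam hrho _ z)).trans ?_
    rw [mul_assoc]
    exact mul_le_mul_right (h n z hz) _
  have hlim : Filter.Tendsto (fun n : ℕ => d * ENNReal.ofReal (c * θ ^ n) * blueOp rho f 0)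
      Filter.atTop (nhds (d * ENNReal.ofReal (c * 0) * blueOp rho f 0)) := by
    refine ENNReal.Tendsto.mul_const (ENNReal.Tendsto.const_mul ?_ (Or.inr (by simp)))
      (Or.inr hfin)
    exact (ENNReal.continuous_ofReal.tendsto _).comp
      ((tendsto_pow_atTop_nhds_zero_of_lt_one hθ0 hθ).const_mul c)
  simp only [mul_zero, ENNReal.ofReal_zero, zero_mul] at hlim
  exact ge_of_tendsto' hlim hle

lemma reach_zero_le (hlam : 0 < lam) (hrho : 0 < rho) (u : ℝ) :
    reach d lam rho 0 u ≤ redOp lam (fun _ => 1) u := by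
  rw [reach_zero hlam hrho]
  exact redOp_mono fun x hx _ => blueOp_one_le hrho.le hx.le

/-- Along a path all of whose vertices are taken by blue, the lifetime of each vertex exceeds both
the blue clock of the vertex and the red clock of the next one. The constant on the right is the
probability of this for one vertex. -/
lemma blueOp_one_sub_exp_le (hlam : 0 < lam) (hrho : 0 < rho) {t : ℝ} (ht : 0 ≤ t) :
    blueOp rho (fun z => ENNReal.ofReal (1 - Real.exp (-(lam * z)))) t ≤
      ENNReal.ofReal (1 / (1 + rho) - rho / ((rho + lam) * (1 + rho + lam))) := by
  have h1 : blueOp rho (fun z => ENNReal.ofReal (1 - Real.exp (-(lam * z)))) t +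
      blueOp rho (fun z => ENNReal.ofReal (Real.exp (-(lam * z)))) t =
      blueOp rho (fun z => ENNReal.ofReal (Real.exp (-(0 * z)))) t := by
    rw [← blueOp_add (by fun_prop)]
    refine le_antisymm (blueOp_mono fun z hz => ?_) (blueOp_mono fun z hz => ?_) <;>
    · have : Real.exp (-(lam * z)) ≤ 1 := Real.exp_le_one_iff.2 (by nlinarith)
      rw [← ENNReal.ofReal_add (by linarith) (Real.exp_nonneg _)]
      simp
  rw [blueOp_exp (by linarith), blueOp_exp (by linarith)] at h1
  rw [ENNReal.eq_sub_of_add_eq ENNReal.ofReal_ne_top h1, ← ENNReal.ofReal_sub _ (by positivity)]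
  refine ENNReal.ofReal_le_ofReal ?_
  simp only [add_zero]
  -- replacing the coefficient of the second term by a smaller one gives a decreasing function
  let p : ℝ → ℝ := fun t => 1 / (1 + rho) * Real.exp (-(rho * t)) +
    -(rho / ((rho + lam) * (1 + rho + lam))) * Real.exp (-((rho + lam) * t))
  have hderiv : ∀ x, HasDerivAt p (1 / (1 + rho) * (Real.exp (-(rho * x)) * -rho) +
      -(rho / ((rho + lam) * (1 + rho + lam))) *
        (Real.exp (-((rho + lam) * x)) * -(rho + lam))) x := fun x =>
    (hasDerivAt_exp_neg_mul rho _ x).add (hasDerivAt_exp_neg_mul (rho + lam) _ x)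
  have hp : AntitoneOn p (Ici 0) := by
    refine antitoneOn_of_deriv_nonpos (convex_Ici 0)
      (fun x _ => (hderiv x).continuousAt.continuousWithinAt)
      (fun x _ => (hderiv x).differentiableAt.differentiableWithinAt) fun x hx => ?_
    rw [interior_Ici] at hx
    rw [(hderiv x).deriv]
    have h1 : Real.exp (-((rho + lam) * x)) ≤ Real.exp (-(rho * x)) :=
      Real.exp_le_exp.2 (by nlinarith [mem_Ioi.1 hx])
    have h2 : 1 / (1 + rho + lam) ≤ 1 / (1 + rho) :=
      one_div_le_one_div_of_le (by positivity) (by linarith)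
    have h3 : 1 / (1 + rho + lam) * Real.exp (-((rho + lam) * x)) ≤
        1 / (1 + rho) * Real.exp (-(rho * x)) := by gcongr
    have h4 : 1 / (1 + rho) * (Real.exp (-(rho * x)) * -rho) +
      -(rho / ((rho + lam) * (1 + rho + lam))) *
        (Real.exp (-((rho + lam) * x)) * -(rho + lam)) =
      rho * (1 / (1 + rho + lam) * Real.exp (-((rho + lam) * x)) -
        1 / (1 + rho) * Real.exp (-(rho * x))) := by
      field_simp
      ring
    rw [h4]
    exact mul_nonpos_of_nonneg_of_nonpos hrho.le (by linarith)
  have h2 := hp self_mem_Ici ht ht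
  simp only [p, mul_zero, neg_zero, Real.exp_zero, mul_one] at h2
  have h3 : rho / ((rho + lam) * (1 + rho + lam)) ≤ 1 / (1 + rho + lam) := by
    rw [div_le_div_iff₀ (by positivity) (by positivity)]
    nlinarith [mul_pos hlam hrho]
  have h4 := mul_le_mul_of_nonneg_right h3 (Real.exp_nonneg (-((rho + lam) * t)))
  have h5 : Real.exp (-(rho * t)) / (1 + rho) = 1 / (1 + rho) * Real.exp (-(rho * t)) := by ring
  have h6 : Real.exp (-((rho + lam) * t)) / (1 + rho + lam) =
    1 / (1 + rho + lam) * Real.exp (-((rho + lam) * t)) := by ring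
  linarith

lemma prob_eventB_eq_zero_of_path (hlam : 0 < lam) (hrho : 0 < rho)
    (h : d * (1 / (1 + rho) - rho / ((rho + lam) * (1 + rho + lam))) < 1) :
    P d lam rho (eventB d) = 0 := by
  set p := 1 / (1 + rho) - rho / ((rho + lam) * (1 + rho + lam)) with hp
  have hp0 : 0 ≤ p := by
    rw [hp, sub_nonneg, div_le_div_iff₀ (by positivity) (by positivity)]
    nlinarith [mul_pos hlam hrho, mul_pos hlam hlam]
  refine prob_eventB_eq_zero_of_reach_le (n₀ := 0) (c := 1) (θ := d * p) hlam hrho (by positivity) h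
    (f := fun z => redOp lam (fun _ => 1) z) (measurable_redOp lam measurable_const) ?_ ?_
  · refine ne_top_of_le_ne_top ENNReal.one_ne_top ?_
    exact (blueOp_mono fun z _ => redOp_one_le hlam z).trans (blueOp_one_le hrho.le le_rfl)
  · intro n
    rw [zero_add]
    induction n with
    | zero =>
      intro z _
      simpa using reach_zero_le hlam hrho z
    | succ n ih =>
      intro z _
      refine (reach_succ_le hlam hrho (measurable_redOp lam measurable_const) ih z).trans ?_
      have h1 : genOp lam rho (fun z => redOp lam (fun _ => 1) z) z ≤
          ENNReal.ofReal p * redOp lam (fun _ => 1) z := by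
        rw [← redOp_const_mul _ measurable_const]
        refine redOp_mono fun x hx _ => ?_
        rw [mul_one]
        refine le_trans (blueOp_mono fun y hy => ?_) (blueOp_one_sub_exp_le hlam hrho hx.le)
        rw [redOp_one hlam (hx.trans hy).le]
      refine (mul_le_mul_right h1 _).trans (le_of_eq ?_)
      rw [one_mul, one_mul, pow_succ, ENNReal.ofReal_mul (by positivity),
        ENNReal.ofReal_mul (Nat.cast_nonneg d), ENNReal.ofReal_natCast]
      ring

lemma exists_prob_eventB_eq_zero (hd : 2 ≤ d) (hlam : 0 < lam) :
    ∃ rho, 0 < rho ∧ rho < lam * ((d : ℝ) - 1) ∧ P d lam rho (eventB d) = 0 := by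
  have hd2 : (2 : ℝ) ≤ d := by exact_mod_cast hd
  set r := lam * ((d : ℝ) - 1) with hr
  have hr0 : 0 < r := mul_pos hlam (by linarith)
  let F : ℝ → ℝ := fun rho => d * (1 / (1 + rho) - rho / ((rho + lam) * (1 + rho + lam)))
  have hFr : F r < 1 := by
    have h1 : r + lam = d * lam := by rw [hr]; ring
    have h2 : 1 + r + lam = 1 + d * lam := by linarith
    simp only [F, h1, h2]
    rw [mul_sub, sub_lt_iff_lt_add, mul_one_div, div_lt_iff₀ (by positivity)]
    have h3 : (d : ℝ) * (r / (d * lam * (1 + d * lam))) = (d - 1) / (1 + d * lam) := by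
      rw [hr]
      field_simp
    rw [h3, hr]
    have h4 : (0 : ℝ) < 1 + d * lam := by positivity
    rw [← sub_pos]
    have h5 : (1 + ((d : ℝ) - 1) / (1 + d * lam)) * (1 + lam * (d - 1)) - d =
        ((d : ℝ) - 1) * d * lam ^ 2 / (1 + d * lam) := by
      field_simp
      ring
    rw [h5]
    have h6 : (0 : ℝ) < d - 1 := by linarith
    positivity
  have hcont : ContinuousAt F r := by
    have h1 : 1 + r ≠ 0 := by positivity
    have h2 : (r + lam) * (1 + r + lam) ≠ 0 := by positivity
    fun_prop (disch := assumption)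
  have hev : ∀ᶠ rho in nhdsWithin r (Iio r), F rho < 1 ∧ 0 < rho ∧ rho < r := by
    have h1 := (hcont.eventually_lt_const hFr).and (lt_mem_nhds hr0)
    filter_upwards [nhdsWithin_le_nhds h1, self_mem_nhdsWithin] with x hx hx2
    exact ⟨hx.1, hx.2, hx2⟩
  obtain ⟨rho, h1, h2, h3⟩ := hev.exists
  exact ⟨rho, h2, h3, prob_eventB_eq_zero_of_path hlam h2 h1⟩

lemma redOp_exp_le (hlam : 0 < lam) {κ : ℝ} (hκ : κ < lam) {u : ℝ} (hu : 0 ≤ u) :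
    redOp lam (fun x => ENNReal.ofReal (Real.exp (-(κ * x)))) u ≤
      ENNReal.ofReal (lam / (lam - κ) * Real.exp (-(κ * u))) := by
  rw [redOp_exp hlam hκ.ne hu]
  refine ENNReal.ofReal_le_ofReal ?_
  have h1 : 0 < lam - κ := sub_pos.2 hκ
  have h2 : 0 ≤ lam / (lam - κ) := by positivity
  have h3 := mul_nonneg h2 (Real.exp_nonneg (-(lam * u)))
  linarith

/-- Each generation improves the exponential decay rate in the time `u` by `rho`, up to the
limit `lam`. -/
lemma exists_reach_le_exp (hlam : 0 < lam) (hrho : 0 < rho) (k : ℕ) {β : ℝ} (h0 : 0 ≤ β)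
    (hβ : β < lam) (hk : β ≤ k * rho) :
    ∃ C : ℝ, 0 < C ∧ ∀ n, k ≤ n → ∀ u, 0 < u →
      reach d lam rho n u ≤ ENNReal.ofReal C * ENNReal.ofReal (Real.exp (-(β * u))) := by
  induction k generalizing β with
  | zero =>
    have hβ0 : β = 0 := le_antisymm (by simpa using hk) h0
    refine ⟨1, one_pos, fun n _ u _ => ?_⟩
    simpa [hβ0] using reach_le_one hlam hrho n u
  | succ k ih =>
    obtain ⟨C, hC, h⟩ := ih (β := max (β - rho) 0) (le_max_right _ _)
      (max_lt (by linarith) hlam) (max_le (by push_cast at hk; linarith) (by positivity))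
    refine ⟨(d + 1) * C * (lam / (lam - β)), by
      have : 0 < lam - β := sub_pos.2 hβ
      positivity, fun n hn u hu => ?_⟩
    obtain ⟨m, rfl⟩ : ∃ m, n = m + 1 := ⟨n - 1, by omega⟩
    refine (reach_succ_le hlam hrho (by fun_prop) (h m (by omega)) u).trans ?_
    have h1 : genOp lam rho (fun z => ENNReal.ofReal (Real.exp (-(max (β - rho) 0 * z)))) u ≤
        ENNReal.ofReal (lam / (lam - β) * Real.exp (-(β * u))) := by
      refine (redOp_mono fun x hx _ => ?_).trans (redOp_exp_le hlam hβ hu.le)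
      have hmax := le_max_right (β - rho) 0
      rw [blueOp_exp (by linarith)]
      refine ENNReal.ofReal_le_ofReal ((div_le_self (Real.exp_nonneg _) (by linarith)).trans ?_)
      refine Real.exp_le_exp.2 (neg_le_neg (mul_le_mul_of_nonneg_right ?_ hx.le))
      linarith [le_max_left (β - rho) 0]
    refine (mul_le_mul_right h1 _).trans ?_
    rw [← ENNReal.ofReal_natCast, ← ENNReal.ofReal_mul (by positivity),
      ← ENNReal.ofReal_mul (by positivity), ← ENNReal.ofReal_mul (by
        have : 0 < lam - β := sub_pos.2 hβ
        positivity)]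
    refine ENNReal.ofReal_le_ofReal ?_
    have h3 : 0 ≤ lam / (lam - β) * Real.exp (-(β * u)) := by
      have : 0 < lam - β := sub_pos.2 hβ
      positivity
    nlinarith [mul_nonneg hC.le h3]

lemma exists_reach_le_exp_of_lt (hlam : 0 < lam) (hrho : 0 < rho) {β : ℝ} (hβ : β < lam) :
    ∃ (C : ℝ) (k : ℕ), 0 < C ∧ ∀ n, k ≤ n → ∀ u, 0 < u →
      reach d lam rho n u ≤ ENNReal.ofReal C * ENNReal.ofReal (Real.exp (-(β * u))) := by
  obtain ⟨k, hk⟩ := exists_nat_ge (max β 0 / rho)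
  obtain ⟨C, hC, h⟩ := exists_reach_le_exp (d := d) hlam hrho k (le_max_right β 0)
    (max_lt hβ hlam) ((div_le_iff₀ hrho).1 hk)
  refine ⟨C, k, hC, fun n hn u hu => (h n hn u hu).trans (mul_le_mul_right ?_ _)⟩
  refine ENNReal.ofReal_le_ofReal (Real.exp_le_exp.2 (neg_le_neg ?_))
  exact mul_le_mul_of_nonneg_right (le_max_left _ _) hu.le

/-- Outside the interval `Λ`, the function `exp (-β z)` with `β = (lam - 1) / 2 - rho` is mapped by
the mean operator to a function smaller by a factor `θ < 1`. -/
lemma prob_eventB_eq_zero_of_mul_le (hlam : 0 < lam) (hrho : 0 < rho)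
    (h : 4 * d * lam ≤ (1 + lam) ^ 2) : P d lam rho (eventB d) = 0 := by
  set β := (lam - 1) / 2 - rho with hβ
  set a := (1 + lam) / 2 with ha
  have ha0 : 0 < a := by positivity
  obtain ⟨C, k, hC, hk⟩ := exists_reach_le_exp_of_lt (d := d) hlam hrho
    (show β < lam by linarith)
  let θ := max (1 - Real.exp (-a)) (Real.exp (-rho))
  have hθ1 : θ < 1 := max_lt (by linarith [Real.exp_pos (-a)])
    (Real.exp_lt_one_iff.2 (by linarith))
  have hθ0 : 0 ≤ θ := (Real.exp_nonneg _).trans (le_max_right _ _)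
  have hθ : ∀ u, 0 < u → (1 - Real.exp (-(a * u))) * Real.exp (-(rho * u)) ≤ θ := by
    intro u hu
    have h1 : Real.exp (-(rho * u)) ≤ 1 := Real.exp_le_one_iff.2 (by nlinarith)
    have h2 : Real.exp (-(a * u)) ≤ 1 := Real.exp_le_one_iff.2 (by nlinarith)
    rcases le_total u 1 with h3 | h3
    · refine le_trans ?_ (le_max_left _ _)
      refine (mul_le_of_le_one_right (by linarith) h1).trans ?_
      have : Real.exp (-a) ≤ Real.exp (-(a * u)) := Real.exp_le_exp.2 (by nlinarith)
      linarith
    · refine le_trans ?_ (le_max_right _ _)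
      refine (mul_le_of_le_one_left (Real.exp_nonneg _) ?_).trans
        (Real.exp_le_exp.2 (by nlinarith))
      linarith [Real.exp_pos (-(a * u))]
  have hβa : 1 + rho + β = a := by rw [hβ, ha]; ring
  refine prob_eventB_eq_zero_of_reach_le (n₀ := k) (c := C) (θ := θ) hlam hrho hθ0 hθ1
    (f := fun z => ENNReal.ofReal (Real.exp (-(β * z)))) (by fun_prop) ?_ ?_
  · rw [blueOp_exp (by linarith)]
    exact ENNReal.ofReal_ne_top
  · intro n
    induction n with
    | zero =>
      intro z hz
      simpa using hk k le_rfl z hz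
    | succ n ih =>
      intro z hz
      refine (reach_succ_le hlam hrho (by fun_prop) ih z).trans ?_
      have h1 : genOp lam rho (fun z => ENNReal.ofReal (Real.exp (-(β * z)))) z =
          ENNReal.ofReal (1 / a) * ENNReal.ofReal (lam / a *
            (Real.exp (-((rho + β) * z)) - Real.exp (-(lam * z)))) := by
        have h2 : lam - (rho + β) = a := by rw [hβ, ha]; ring
        rw [← h2, ← redOp_exp hlam (by linarith) hz.le, ← redOp_const_mul _ (by fun_prop), genOp]
        congr 1
        funext t
        rw [blueOp_exp (by linarith), hβa, ← ENNReal.ofReal_mul (by rw [h2]; positivity), h2]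
        congr 1
        ring
      rw [h1, ← ENNReal.ofReal_natCast, ← ENNReal.ofReal_mul (by positivity),
        ← ENNReal.ofReal_mul (by positivity), ← ENNReal.ofReal_mul (by positivity),
        ← ENNReal.ofReal_mul (by positivity)]
      refine ENNReal.ofReal_le_ofReal ?_
      have h3 : Real.exp (-((rho + β) * z)) - Real.exp (-(lam * z)) =
          (1 - Real.exp (-(a * z))) * Real.exp (-(rho * z)) * Real.exp (-(β * z)) := by
        rw [sub_mul, one_mul, sub_mul, ← Real.exp_add, ← Real.exp_add, ← Real.exp_add]
        congr 2
        · ring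
        · rw [hβ, ha]
          ring
      have h4 : (d : ℝ) * lam / a ^ 2 ≤ 1 := by
        rw [div_le_one (by positivity), ha]
        nlinarith
      rw [h3, pow_succ]
      have h5 := mul_le_mul_of_nonneg_right (hθ z hz) (Real.exp_nonneg (-(β * z)))
      have h6 : 0 ≤ C * θ ^ n := by positivity
      calc (d : ℝ) * (C * θ ^ n) * (1 / a * (lam / a *
            ((1 - Real.exp (-(a * z))) * Real.exp (-(rho * z)) * Real.exp (-(β * z)))))
          = (d * lam / a ^ 2) * ((C * θ ^ n) *
            ((1 - Real.exp (-(a * z))) * Real.exp (-(rho * z)) * Real.exp (-(β * z)))) := by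
            field_simp
        _ ≤ 1 * ((C * θ ^ n) * (θ * Real.exp (-(β * z)))) := by
            gcongr
            have : Real.exp (-(a * z)) ≤ 1 := Real.exp_le_one_iff.2 (by nlinarith)
            have : 0 ≤ 1 - Real.exp (-(a * z)) := by linarith
            positivity
        _ = C * (θ ^ n * θ) * Real.exp (-(β * z)) := by ring

end extinction

/-! ### Survival of blue from test functions -/

section survival

variable {d : ℕ} {lam rho : ℝ}

lemma le_reach (hlam : 0 < lam) (hrho : 0 < rho) {ψ : ℝ → ℝ≥0∞}
    (hψ : ∀ u, 0 < u → ψ u ≤ genOp lam rho (fun z => anyOf d (ψ z)) u) (n : ℕ) (u : ℝ)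
    (hu : 0 < u) : ψ u ≤ reach d lam rho n u := by
  induction n generalizing u with
  | zero =>
    rw [reach_zero hlam hrho]
    exact (hψ u hu).trans (genOp_mono (fun z _ => anyOf_le_one _) u)
  | succ n ih =>
    rw [reach_succ hlam hrho]
    exact (hψ u hu).trans (genOp_mono (fun z hz => anyOf_mono (ih z hz)) u)

/-- A bounded test function which the mean operator enlarges by a factor `c > 1` bounds, after
multiplication by a small constant, the survival probability of blue from below. -/
lemma prob_eventB_pos_of_test (hd : d ≠ 0) (hlam : 0 < lam) (hrho : 0 < rho) {f : ℝ → ℝ≥0∞}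
    (hf : Measurable f) {M c : ℝ} (hM : 0 < M) (hfM : ∀ z, f z ≤ ENNReal.ofReal M) (hc : 1 < c)
    (h : ∀ u, 0 < u → ENNReal.ofReal c * f u ≤ genOp lam rho (fun z => d * f z) u)
    (h0 : blueOp rho f 0 ≠ 0) : 0 < P d lam rho (eventB d) := by
  have hd0 : (0 : ℝ) < d := by exact_mod_cast Nat.pos_of_ne_zero hd
  have hd1 : (1 : ℝ) ≤ d := by exact_mod_cast Nat.one_le_iff_ne_zero.2 hd
  -- `η` solves `(1 - d * η) * c = 1`
  let η : ℝ := (1 - 1 / c) / d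
  have hc1 : 1 / c < 1 := by rw [div_lt_one (by linarith)]; exact hc
  have hc0 : 0 < 1 / c := by positivity
  have hη0 : 0 < η := div_pos (by linarith) hd0
  have hη1 : η ≤ 1 := by
    rw [div_le_one hd0]
    linarith
  have hη : 1 - d * η = 1 / c := by
    simp only [η]
    field_simp
    ring
  let ψ : ℝ → ℝ≥0∞ := fun z => ENNReal.ofReal (η / M) * f z
  have hψη : ∀ z, ψ z ≤ ENNReal.ofReal η := fun z => by
    refine (mul_le_mul_right (hfM z) _).trans ?_
    rw [← ENNReal.ofReal_mul (by positivity), div_mul_cancel₀ _ hM.ne']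
  have hψ : ∀ z, ENNReal.ofReal (1 / c) * ENNReal.ofReal (η / M) * (d * f z) ≤
      anyOf d (ψ z) := fun z => by
    refine le_trans (le_of_eq ?_) (le_anyOf hη0.le hη1 (hψη z))
    rw [hη]
    simp only [ψ]
    ring
  have hreach : ∀ n u, 0 < u → ψ u ≤ reach d lam rho n u := by
    refine le_reach hlam hrho fun u hu => ?_
    refine le_trans ?_ (genOp_mono (fun z _ => hψ z) u)
    rw [genOp_const_mul _ (by fun_prop)]
    refine le_trans (le_of_eq ?_) (mul_le_mul_right (h u hu) _)
    have : ENNReal.ofReal (1 / c) * ENNReal.ofReal c = 1 := by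
      rw [← ENNReal.ofReal_mul hc0.le, one_div_mul_cancel (by linarith), ENNReal.ofReal_one]
    calc ψ u = (ENNReal.ofReal (1 / c) * ENNReal.ofReal c) * ψ u := by rw [this, one_mul]
      _ = _ := by
        simp only [ψ]
        ring
  have hpos : 0 < ENNReal.ofReal (1 / c) * ENNReal.ofReal (η / M) * (d * blueOp rho f 0) := by
    refine ENNReal.mul_pos (mul_ne_zero ?_ ?_) (mul_ne_zero (by simpa using hd) h0)
    · exact (ENNReal.ofReal_pos.2 hc0).ne'
    · exact (ENNReal.ofReal_pos.2 (by positivity)).ne'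
  refine hpos.trans_le ?_
  have hsucc : ∀ n, ENNReal.ofReal (1 / c) * ENNReal.ofReal (η / M) * (d * blueOp rho f 0) ≤
      P d lam rho {ω | BlueAt (n + 1) 0 ω} := by
    intro n
    rw [prob_blueAt_succ hlam hrho n le_rfl, ← blueOp_const_mul _ hf,
      ← blueOp_const_mul _ (by fun_prop)]
    exact blueOp_mono fun z hz => (hψ z).trans (anyOf_mono (hreach n z hz))
  rw [prob_eventB hlam hrho]
  refine le_iInf fun n => (hsucc n).trans ?_
  exact measure_mono fun ω (hω : BlueAt (n + 1) 0 ω) => hω.mono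

lemma blueOp_ne_zero_iff {g : ℝ → ℝ≥0∞} (hg : Measurable g) {t : ℝ} :
    blueOp rho g t ≠ 0 ↔ volume ({z | g z ≠ 0} ∩ Ioi t) ≠ 0 := by
  rw [Ne, blueOp, lintegral_eq_zero_iff (by fun_prop), Filter.EventuallyEq, ae_iff,
    Measure.restrict_apply₀' measurableSet_Ioi.nullMeasurableSet]
  simp only [Pi.zero_apply, mul_eq_zero, not_or]
  have h1 : {z | ¬ENNReal.ofReal (Real.exp (t - z) * Real.exp (-(rho * z))) = 0 ∧ ¬g z = 0} =
      {z | g z ≠ 0} := by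
    ext z
    simp only [mem_ofPred_eq, ne_eq, and_iff_right_iff_imp]
    exact fun _ => (ENNReal.ofReal_pos.2 (by positivity)).ne'
  rw [h1]

lemma blueOp_zero_ne_zero_of_pos {g : ℝ → ℝ≥0∞} (hg : Measurable g) {Z : ℝ} (hZ : 0 < Z)
    (h : ∀ z, 0 < z → z < Z → g z ≠ 0) : blueOp rho g 0 ≠ 0 := by
  rw [blueOp_ne_zero_iff hg]
  have h1 : Ioo 0 Z ⊆ {z | g z ≠ 0} ∩ Ioi 0 := fun z hz => ⟨h z hz.1 hz.2, hz.1⟩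
  have h2 : 0 < volume (Ioo 0 Z) := by simpa using hZ
  exact (h2.trans_le (measure_mono h1)).ne'

/-- Being a compactly supported test function for survival is an open condition on the death
rate. -/
lemma exists_forall_prob_eventB_pos (hd : d ≠ 0) (hlam : 0 < lam) {rho₀ : ℝ}
    {f : ℝ → ℝ≥0∞} (hf : Measurable f) {M c Z : ℝ} (hM : 0 < M) (hZ : 0 < Z)
    (hfM : ∀ z, f z ≤ ENNReal.ofReal M) (hc : 1 < c) (hsupp : ∀ z, Z < z → f z = 0)
    (h : ∀ u, 0 < u → ENNReal.ofReal c * f u ≤ genOp lam rho₀ (fun z => d * f z) u)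
    (h0 : blueOp rho₀ f 0 ≠ 0) :
    ∃ ε > 0, ∀ rho, 0 < rho → rho < rho₀ + ε → 0 < P d lam rho (eventB d) := by
  refine ⟨Real.log c / (2 * Z), div_pos (Real.log_pos hc) (by positivity), fun rho hrho hlt => ?_⟩
  set s := max (rho - rho₀) 0 with hs
  have hs0 : 0 ≤ s := le_max_right _ _
  have hsZ : s * Z ≤ Real.log c / 2 := by
    have : s ≤ Real.log c / (2 * Z) :=
      max_le (by linarith) (div_pos (Real.log_pos hc) (by positivity)).le
    calc s * Z ≤ Real.log c / (2 * Z) * Z := by gcongr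
      _ = Real.log c / 2 := by field_simp
  have hcmp : ∀ t, 0 ≤ t → blueOp rho₀ (fun z => ENNReal.ofReal (Real.exp (-(s * Z))) * (d * f z)) t
      ≤ blueOp rho (fun z => d * f z) t := by
    intro t ht
    refine setLIntegral_mono' measurableSet_Ioi fun z hz => ?_
    rcases lt_or_ge Z z with hz2 | hz2
    · simp [hsupp z hz2]
    · rw [← mul_assoc]
      gcongr
      rw [← ENNReal.ofReal_mul (by positivity)]
      refine ENNReal.ofReal_le_ofReal ?_
      rw [mul_assoc, ← Real.exp_add]
      gcongr
      have hz0 : 0 ≤ z := ht.trans (le_of_lt hz)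
      have h1 : (rho - rho₀) * z ≤ s * Z :=
        (mul_le_mul_of_nonneg_right (le_max_left _ _) hz0).trans (by gcongr)
      linarith
  refine prob_eventB_pos_of_test hd hlam hrho hf hM hfM (c := Real.exp (-(s * Z)) * c) ?_ ?_ ?_
  · have h1 : Real.exp (-(Real.log c / 2)) * c ≤ Real.exp (-(s * Z)) * c := by gcongr
    refine lt_of_lt_of_le ?_ h1
    nth_rewrite 2 [← Real.exp_log (by linarith : 0 < c)]
    rw [← Real.exp_add, Real.one_lt_exp_iff]
    linarith [Real.log_pos hc]
  · intro u hu
    rw [ENNReal.ofReal_mul (Real.exp_nonneg _), mul_assoc]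
    refine (mul_le_mul_right (h u hu) _).trans ?_
    rw [← genOp_const_mul _ (by fun_prop)]
    exact redOp_mono fun x hx _ => hcmp x hx.le
  · rw [blueOp_ne_zero_iff hf] at h0 ⊢
    exact h0

end survival

/-! ### Survival of blue for small death rates -/

/-- Inside the interval `Λ`, the mean operator without deaths for a smaller number `d'` of children
has the oscillating eigenfunction `exp (α z) * sin (β z)`, `α = (1 - lam) / 2`; its restriction to
the first half period is a test function. -/
lemma exists_small_prob_eventB_pos {d : ℕ} {lam : ℝ} (hd : d ≠ 0) (hlam : 0 < lam)
    (h : (1 + lam) ^ 2 < 4 * d * lam) :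
    ∃ ε > 0, ∀ rho, 0 < rho → rho < ε → 0 < P d lam rho (eventB d) := by
  set s := (1 + lam) / 2 with hs
  set α := (1 - lam) / 2 with hα
  have hs0 : 0 < s := by positivity
  have hsd : s ^ 2 < d * lam := by rw [hs]; nlinarith
  set d' := (d + s ^ 2 / lam) / 2 with hd'
  have hd'lam : d' * lam = (d * lam + s ^ 2) / 2 := by rw [hd']; field_simp
  have hd'0 : 0 < d' := by positivity
  have hd'd : d' < d := by
    have : s ^ 2 / lam < d := by rwa [div_lt_iff₀ hlam]
    rw [hd']
    linarith
  set β := √(d' * lam - s ^ 2) with hβ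
  have hpos : 0 < d' * lam - s ^ 2 := by rw [hd'lam]; linarith
  have hβ0 : 0 < β := Real.sqrt_pos.2 hpos
  have hβ2 : β ^ 2 = d' * lam - s ^ 2 := Real.sq_sqrt hpos.le
  set Z := Real.pi / β with hZdef
  have hZ : 0 < Z := div_pos Real.pi_pos hβ0
  have hβZ : β * Z = Real.pi := by rw [hZdef]; field_simp
  have hsin : ∀ z ∈ Icc 0 Z, 0 ≤ Real.sin (β * z) := fun z hz =>
    Real.sin_nonneg_of_nonneg_of_le_pi (mul_nonneg hβ0.le hz.1)
      (by rw [← hβZ]; exact mul_le_mul_of_nonneg_left hz.2 hβ0.le)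
  have hdsin : ∀ x, HasDerivAt (fun z => Real.sin (β * z)) (β * Real.cos (β * x)) x := fun x => by
    simpa [mul_comm] using ((hasDerivAt_id x).const_mul β).sin
  have hdcos : ∀ x, HasDerivAt (fun z => Real.cos (β * z)) (-(β * Real.sin (β * x))) x :=
    fun x => by simpa [mul_comm] using ((hasDerivAt_id x).const_mul β).cos
  have hdexp : ∀ a x, HasDerivAt (fun z => Real.exp (a * z)) (a * Real.exp (a * x)) x :=
    fun a x => by simpa [mul_comm] using ((hasDerivAt_id x).const_mul a).exp
  -- the two primitives that verify the eigenfunction equation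
  let G : ℝ → ℝ := fun z =>
    -(Real.exp (-s * z) * (s * Real.sin (β * z) + β * Real.cos (β * z))) / lam
  have hG : ∀ z, HasDerivAt G (d' * Real.exp (-s * z) * Real.sin (β * z)) z := by
    intro z
    have h1 := (((hdexp (-s) z).mul
      (((hdsin z).const_mul s).add ((hdcos z).const_mul β))).neg).div_const lam
    refine h1.congr_deriv ?_
    simp only [Pi.add_apply]
    rw [div_eq_iff hlam.ne']
    linear_combination (Real.exp (-s * z) * Real.sin (β * z)) * hβ2
  have hGmono : MonotoneOn G (Icc 0 Z) := by
    refine monotoneOn_of_deriv_nonneg (convex_Icc 0 Z)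
      (fun x _ => (hG x).continuousAt.continuousWithinAt)
      (fun x _ => (hG x).differentiableAt.differentiableWithinAt) fun x hx => ?_
    rw [(hG x).deriv]
    have := hsin x (interior_subset hx)
    positivity
  have hGZ : 0 ≤ G Z := by
    simp only [G, hβZ, Real.sin_pi, Real.cos_pi, mul_zero, zero_add, mul_neg, mul_one, neg_neg]
    positivity
  let J : ℝ → ℝ := fun x => Real.exp (s * x) * Real.sin (β * x) +
    lam * G Z / (1 + lam) * Real.exp ((1 + lam) * x)
  have hJ : ∀ x, HasDerivAt J (lam * (Real.exp ((1 + lam) * x) * (G Z - G x))) x := by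
    intro x
    have h1 := ((hdexp s x).mul (hdsin x)).add
      ((hdexp (1 + lam) x).const_mul (lam * G Z / (1 + lam)))
    refine h1.congr_deriv ?_
    have h2 : Real.exp (s * x) = Real.exp ((1 + lam) * x) * Real.exp (-s * x) := by
      rw [← Real.exp_add]
      congr 1
      rw [hs]
      ring
    simp only [G, h2]
    field_simp
    ring
  let f : ℝ → ℝ≥0∞ := (Icc 0 Z).indicator fun z =>
    ENNReal.ofReal (Real.exp (α * z) * Real.sin (β * z))
  have hf : Measurable f := by
    refine Measurable.indicator ?_ measurableSet_Icc
    fun_prop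
  have hblue : ∀ t, 0 < t → t < Z →
      ENNReal.ofReal (Real.exp t * (G Z - G t)) ≤ blueOp 0 (fun z => ENNReal.ofReal d' * f z) t := by
    intro t ht htZ
    rw [ENNReal.ofReal_mul (Real.exp_nonneg _), ← lintegral_Ioo_of_hasDerivAt htZ.le hG
      (by fun_prop) (fun x hx => by
        have := hsin x ⟨(ht.trans hx.1).le, hx.2.le⟩
        positivity), ← lintegral_const_mul _ (by fun_prop), blueOp]
    refine le_trans (setLIntegral_mono' measurableSet_Ioo fun z hz => ?_)
      (lintegral_mono_set Ioo_subset_Ioi_self)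
    have hz' : z ∈ Icc 0 Z := ⟨(ht.trans hz.1).le, hz.2.le⟩
    have h1 := hsin z hz'
    simp only [f, indicator_of_mem hz']
    rw [← ENNReal.ofReal_mul (by positivity), ← ENNReal.ofReal_mul (by positivity),
      ← ENNReal.ofReal_mul (by positivity)]
    refine le_of_eq (congrArg _ ?_)
    have h2 : Real.exp (t - z) * Real.exp (-(0 * z)) * Real.exp (α * z) =
        Real.exp t * Real.exp (-s * z) := by
      rw [← Real.exp_add, ← Real.exp_add, ← Real.exp_add]
      congr 1
      rw [hα, hs]
      ring
    linear_combination (-(d' * Real.sin (β * z))) * h2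
  have hgen : ∀ u, 0 < u → f u ≤ genOp lam 0 (fun z => ENNReal.ofReal d' * f z) u := by
    intro u hu
    rcases lt_or_ge Z u with huZ | huZ
    · simp [f, huZ]
    have hu' : u ∈ Icc 0 Z := ⟨hu.le, huZ⟩
    have h1 : redOp lam (fun x => ENNReal.ofReal (Real.exp x * (G Z - G x))) u ≤
        genOp lam 0 (fun z => ENNReal.ofReal d' * f z) u :=
      redOp_mono fun x hx hxu => hblue x hx (hxu.trans_le huZ)
    refine le_trans ?_ h1
    have hGc : Continuous G := continuous_iff_continuousAt.2 fun x => (hG x).continuousAt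
    have h2 : redOp lam (fun x => ENNReal.ofReal (Real.exp x * (G Z - G x))) u =
        ENNReal.ofReal (Real.exp (-(lam * u))) * ∫⁻ x in Ioo 0 u,
          ENNReal.ofReal (lam * (Real.exp ((1 + lam) * x) * (G Z - G x))) := by
      rw [redOp, ← lintegral_const_mul _ (by fun_prop)]
      refine lintegral_congr fun x => ?_
      rw [← ENNReal.ofReal_mul (by positivity), ← ENNReal.ofReal_mul (by positivity)]
      congr 1
      have h3 : Real.exp (-(lam * (u - x))) * Real.exp x =
          Real.exp (-(lam * u)) * Real.exp ((1 + lam) * x) := by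
        rw [← Real.exp_add, ← Real.exp_add]
        congr 1
        ring
      linear_combination (lam * (G Z - G x)) * h3
    rw [h2, lintegral_Ioo_of_hasDerivAt hu.le hJ (by fun_prop) (fun x hx => by
      have := hGmono ⟨hx.1.le, (hx.2.trans_le huZ).le⟩ ⟨hZ.le, le_rfl⟩ (hx.2.trans_le huZ).le
      have := sub_nonneg.2 this
      positivity), ← ENNReal.ofReal_mul (Real.exp_nonneg _)]
    simp only [f, indicator_of_mem hu']
    refine ENNReal.ofReal_le_ofReal ?_
    simp only [J, mul_zero, Real.exp_zero, Real.sin_zero, mul_one, zero_add]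
    have h4 : Real.exp (α * u) = Real.exp (-(lam * u)) * Real.exp (s * u) := by
      rw [← Real.exp_add]
      congr 1
      rw [hα, hs]
      ring
    rw [h4, mul_assoc]
    refine mul_le_mul_of_nonneg_left ?_ (Real.exp_nonneg _)
    have h5 : 1 ≤ Real.exp ((1 + lam) * u) := Real.one_le_exp (by positivity)
    have h6 : 0 ≤ lam * G Z / (1 + lam) := by positivity
    nlinarith
  suffices hsurv : ∃ ε > 0, ∀ rho, 0 < rho → rho < 0 + ε → 0 < P d lam rho (eventB d) by
    simpa only [zero_add] using hsurv
  refine exists_forall_prob_eventB_pos (rho₀ := 0) hd hlam hf (M := Real.exp (|α| * Z))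
    (c := d / d') (Z := Z) (Real.exp_pos _) hZ ?_ ?_ ?_ ?_ ?_
  · intro z
    by_cases hz : z ∈ Icc 0 Z
    · simp only [f, indicator_of_mem hz]
      refine ENNReal.ofReal_le_ofReal ?_
      refine (mul_le_of_le_one_right (Real.exp_nonneg _) (Real.sin_le_one _)).trans ?_
      refine Real.exp_le_exp.2 ?_
      exact (mul_le_mul_of_nonneg_right (le_abs_self α) hz.1).trans
        (mul_le_mul_of_nonneg_left hz.2 (abs_nonneg α))
    · simp [f, hz]
  · rwa [one_lt_div hd'0]
  · intro z hz
    simp [f, hz]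
  · intro u hu
    refine (mul_le_mul_right (hgen u hu) _).trans (le_of_eq ?_)
    rw [← genOp_const_mul _ (by fun_prop)]
    congr 1
    funext z
    rw [← mul_assoc, ← ENNReal.ofReal_mul (by positivity), div_mul_cancel₀ _ hd'0.ne',
      ENNReal.ofReal_natCast]
  · refine blueOp_zero_ne_zero_of_pos hf hZ fun z hz hzZ => ?_
    simp only [f, indicator_of_mem (show z ∈ Icc 0 Z from ⟨hz.le, hzZ.le⟩)]
    have h1 : 0 < Real.sin (β * z) := Real.sin_pos_of_pos_of_lt_pi (by positivity) (by
      rw [← hβZ]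
      exact mul_lt_mul_of_pos_left hzZ hβ0)
    exact (ENNReal.ofReal_pos.2 (by positivity)).ne'

/-! ### Survival of blue is an open condition -/

section openness

variable {d : ℕ} {lam rho : ℝ}

/-- The order of magnitude, near `0` and near infinity, of the survival probability of an edge. -/
noncomputable def profile (lam u : ℝ) : ℝ≥0∞ :=
  ENNReal.ofReal (Real.exp (-(lam * u)) * min u 1)

lemma profile_ne_zero {u : ℝ} (hu : 0 < u) : profile lam u ≠ 0 :=
  (ENNReal.ofReal_pos.2 (by positivity)).ne'

lemma profile_le (u : ℝ) : profile lam u ≤ ENNReal.ofReal (Real.exp (-(lam * u))) :=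
  ENNReal.ofReal_le_ofReal
    (mul_le_of_le_one_right (Real.exp_nonneg _) (min_le_right _ _))

lemma exists_le_blueOp {k : ℝ → ℝ≥0∞} (hk : Measurable k) (h : blueOp rho k 0 ≠ 0) :
    ∃ a m : ℝ, 0 < a ∧ a ≤ 1 ∧ 0 < m ∧ ∀ t, t < a → 0 < t → ENNReal.ofReal m ≤ blueOp rho k t := by
  obtain ⟨n, hn⟩ : ∃ n : ℕ, blueOp rho k (1 / ((n : ℝ) + 1)) ≠ 0 := by
    by_contra! hn
    rw [blueOp_ne_zero_iff hk] at h
    refine h (measure_mono_null (t := ⋃ n : ℕ, {z | k z ≠ 0} ∩ Ioi (1 / ((n : ℝ) + 1))) ?_ ?_)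
    · rintro z ⟨hz1, hz2⟩
      obtain ⟨n, hn⟩ := exists_nat_one_div_lt (mem_Ioi.1 hz2)
      exact mem_iUnion.2 ⟨n, hz1, hn⟩
    · refine measure_iUnion_null fun n => ?_
      by_contra hne
      exact (blueOp_ne_zero_iff (rho := rho) hk).2 hne (hn n)
  set a : ℝ := 1 / ((n : ℝ) + 1) with ha
  have ha0 : 0 < a := by positivity
  have ha1 : a ≤ 1 := by
    rw [ha, div_le_one (by positivity)]
    linarith [Nat.cast_nonneg (α := ℝ) n]
  have hi : 0 < (min (blueOp rho k a) 1).toReal :=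
    ENNReal.toReal_pos (by simp [hn]) (by simp)
  refine ⟨a, Real.exp (-a) * (min (blueOp rho k a) 1).toReal, ha0, ha1, by positivity,
    fun t hta ht => ?_⟩
  rw [ENNReal.ofReal_mul (Real.exp_nonneg _), ENNReal.ofReal_toReal (by simp)]
  refine (mul_le_mul_right (min_le_left _ _) _).trans ?_
  rw [← blueOp_const_mul _ hk]
  refine le_trans (setLIntegral_mono' measurableSet_Ioi fun z hz => ?_)
    (lintegral_mono_set (Ioi_subset_Ioi hta.le))
  rw [← mul_assoc, ← ENNReal.ofReal_mul (by positivity), mul_right_comm (Real.exp _),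
    ← Real.exp_add]
  gcongr
  linarith

/-- The image of a nonzero function under the mean operator is at least of the order of
`profile`. -/
lemma exists_le_genOp (hlam : 0 < lam) {k : ℝ → ℝ≥0∞} (hk : Measurable k)
    (h : blueOp rho k 0 ≠ 0) :
    ∃ c : ℝ, 0 < c ∧ ∀ u, 0 < u → ENNReal.ofReal c * profile lam u ≤ genOp lam rho k u := by
  obtain ⟨a, m, ha0, ha1, hm, hmk⟩ := exists_le_blueOp hk h
  refine ⟨lam * m * a, by positivity, fun u hu => ?_⟩
  have h1 : ∫⁻ x in Ioo 0 (min u a), ENNReal.ofReal (lam * Real.exp (-(lam * u))) *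
      ENNReal.ofReal m ≤ genOp lam rho k u := by
    refine le_trans (setLIntegral_mono' measurableSet_Ioo fun x hx => ?_)
      (lintegral_mono_set (Ioo_subset_Ioo_right (min_le_left u a)))
    refine mul_le_mul' (ENNReal.ofReal_le_ofReal ?_) (hmk x (hx.2.trans_le (min_le_right _ _)) hx.1)
    gcongr
    linarith [hx.1]
  refine le_trans ?_ h1
  rw [lintegral_const, Measure.restrict_apply_univ, Real.volume_Ioo, sub_zero, profile,
    ← ENNReal.ofReal_mul (by positivity), ← ENNReal.ofReal_mul (by positivity),
    ← ENNReal.ofReal_mul (by positivity)]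
  refine ENNReal.ofReal_le_ofReal ?_
  have h2 : a * min u 1 ≤ min u a := by
    refine le_min ?_ ?_
    · exact (mul_le_mul ha1 (min_le_left u 1) (by positivity) zero_le_one).trans (one_mul u).le
    · exact mul_le_of_le_one_right ha0.le (min_le_right u 1)
  calc lam * m * a * (Real.exp (-(lam * u)) * min u 1)
      = lam * Real.exp (-(lam * u)) * m * (a * min u 1) := by ring
    _ ≤ lam * Real.exp (-(lam * u)) * m * min u a := by gcongr

/-- The image of an exponentially decaying function under the mean operator is at most of the order
of `profile`, if the rate of decay exceeds `lam - rho`. -/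
lemma exists_genOp_exp_le (hlam : 0 < lam) {β : ℝ} (hβ : lam - rho < β) :
    ∃ C : ℝ, 0 < C ∧ ∀ u, 0 < u →
      genOp lam rho (fun z => ENNReal.ofReal (Real.exp (-(β * z)))) u ≤
        ENNReal.ofReal C * profile lam u := by
  set δ := rho + β - lam with hδ
  have hδ0 : 0 < δ := by linarith
  refine ⟨lam * (1 + δ) / δ, by positivity, fun u hu => ?_⟩
  have h1 : genOp lam rho (fun z => ENNReal.ofReal (Real.exp (-(β * z)))) u ≤
      redOp lam (fun x => ENNReal.ofReal (Real.exp (-((rho + β) * x)))) u := by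
    refine redOp_mono fun x _ _ => ?_
    rw [blueOp_exp (by linarith)]
    exact ENNReal.ofReal_le_ofReal (div_le_self (Real.exp_nonneg _) (by linarith))
  refine h1.trans ?_
  rw [redOp_exp hlam (by linarith) hu.le, profile, ← ENNReal.ofReal_mul (by positivity)]
  refine ENNReal.ofReal_le_ofReal ?_
  have h2 : Real.exp (-((rho + β) * u)) = Real.exp (-(lam * u)) * Real.exp (-(δ * u)) := by
    rw [← Real.exp_add]
    congr 1
    rw [hδ]
    ring
  have h3 : lam - (rho + β) = -δ := by rw [hδ]; ring
  have h4 : 1 - Real.exp (-(δ * u)) ≤ (1 + δ) * min u 1 := by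
    rcases le_total u 1 with hu1 | hu1
    · rw [min_eq_left hu1]
      linarith [Real.add_one_le_exp (-(δ * u))]
    · rw [min_eq_right hu1]
      linarith [Real.exp_pos (-(δ * u))]
  calc lam / (lam - (rho + β)) * (Real.exp (-((rho + β) * u)) - Real.exp (-(lam * u)))
      = lam / δ * (Real.exp (-(lam * u)) * (1 - Real.exp (-(δ * u)))) := by
        rw [h2, h3]
        field_simp
        ring
    _ ≤ lam / δ * (Real.exp (-(lam * u)) * ((1 + δ) * min u 1)) := by gcongr
    _ = lam * (1 + δ) / δ * (Real.exp (-(lam * u)) * min u 1) := by ring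

lemma tendsto_blueOp (hrho : 0 ≤ rho) {g : ℕ → ℝ → ℝ≥0∞} {g' : ℝ → ℝ≥0∞}
    (hg : ∀ n, Measurable (g n)) (hg1 : ∀ n z, g n z ≤ 1)
    (h : ∀ z, Filter.Tendsto (fun n => g n z) Filter.atTop (nhds (g' z))) {t : ℝ} (ht : 0 ≤ t) :
    Filter.Tendsto (fun n => blueOp rho (g n) t) Filter.atTop (nhds (blueOp rho g' t)) := by
  refine tendsto_lintegral_of_dominated_convergence _ (fun n => by fun_prop)
    (fun n => ae_of_all _ fun z => mul_le_mul_right (hg1 n z) _)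
    (ne_top_of_le_ne_top ENNReal.one_ne_top (blueOp_one_le hrho ht)) (ae_of_all _ fun z => ?_)
  exact ENNReal.Tendsto.const_mul (h z) (Or.inr ENNReal.ofReal_ne_top)

lemma tendsto_genOp (hlam : 0 < lam) (hrho : 0 ≤ rho) {g : ℕ → ℝ → ℝ≥0∞} {g' : ℝ → ℝ≥0∞}
    (hg : ∀ n, Measurable (g n)) (hg1 : ∀ n z, g n z ≤ 1)
    (h : ∀ z, Filter.Tendsto (fun n => g n z) Filter.atTop (nhds (g' z))) (u : ℝ) :
    Filter.Tendsto (fun n => genOp lam rho (g n) u) Filter.atTop (nhds (genOp lam rho g' u)) := by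
  have hm : ∀ n, Measurable (blueOp rho (g n)) := fun n => measurable_blueOp rho (hg n)
  refine tendsto_lintegral_of_dominated_convergence _ (fun n => by fun_prop)
    (fun n => (ae_restrict_iff' measurableSet_Ioo).2 (ae_of_all _ fun x hx =>
      mul_le_mul_right ((blueOp_mono fun z _ => hg1 n z).trans (blueOp_one_le hrho hx.1.le)) _))
    (ne_top_of_le_ne_top ENNReal.one_ne_top (redOp_one_le hlam u))
    ((ae_restrict_iff' measurableSet_Ioo).2 (ae_of_all _ fun x hx => ?_))
  exact ENNReal.Tendsto.const_mul (tendsto_blueOp hrho hg hg1 h hx.1.le)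
    (Or.inr ENNReal.ofReal_ne_top)

lemma antitone_reach : Antitone (reach d lam rho) :=
  antitone_nat_of_succ_le fun _ _ => measure_mono fun _ hω => ⟨hω.1, BlueAt.mono hω.2⟩

/-- The limit `y` of the edge probabilities. -/
noncomputable def reachLim (d : ℕ) (lam rho u : ℝ) : ℝ≥0∞ := ⨅ n, reach d lam rho n u

lemma tendsto_anyOf_reach (u : ℝ) :
    Filter.Tendsto (fun n => anyOf d (reach d lam rho n u)) Filter.atTop
      (nhds (anyOf d (reachLim d lam rho u))) :=
  (continuous_anyOf.tendsto _).comp (tendsto_atTop_iInf fun _ _ h => antitone_reach h u)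

lemma reachLim_eq (hlam : 0 < lam) (hrho : 0 < rho) (u : ℝ) :
    reachLim d lam rho u = genOp lam rho (fun z => anyOf d (reachLim d lam rho z)) u := by
  have h1 : Filter.Tendsto (fun n => reach d lam rho (n + 1) u) Filter.atTop
      (nhds (reachLim d lam rho u)) :=
    (tendsto_atTop_iInf fun _ _ h => antitone_reach h u).comp (Filter.tendsto_add_atTop_nat 1)
  refine tendsto_nhds_unique h1 ?_
  simp only [reach_succ hlam hrho]
  exact tendsto_genOp hlam hrho.le (fun n => measurable_anyOf (measurable_reach hlam hrho n))
    (fun _ _ => anyOf_le_one _) tendsto_anyOf_reach u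

lemma prob_eventB_eq (hlam : 0 < lam) (hrho : 0 < rho) :
    P d lam rho (eventB d) = blueOp rho (fun z => anyOf d (reachLim d lam rho z)) 0 := by
  have h1 : Filter.Tendsto (fun n => P d lam rho {ω | BlueAt (n + 1) 0 ω}) Filter.atTop
      (nhds (P d lam rho (eventB d))) := by
    rw [prob_eventB hlam hrho]
    exact (tendsto_atTop_iInf (antitone_nat_of_succ_le fun n => measure_mono
      fun ω (hω : BlueAt (n + 1) 0 ω) => hω.mono)).comp (Filter.tendsto_add_atTop_nat 1)
  refine tendsto_nhds_unique h1 ?_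
  simp only [prob_blueAt_succ hlam hrho _ le_rfl]
  exact tendsto_blueOp hrho.le (fun n => measurable_anyOf (measurable_reach hlam hrho n))
    (fun _ _ => anyOf_le_one _) tendsto_anyOf_reach le_rfl

/-- If blue survives at `rho`, then it survives at slightly larger death rates. As `anyOf d y < d y`,
the limit `y` of the edge probabilities is enlarged by the mean operator `K = genOp ∘ (d • ·)`; hence
so is `K y`, and by a definite factor, since `K y` and its increment under `K` are both comparable
to `profile`. A truncation of `K y` is then a test function. -/
lemma exists_gt_forall_prob_eventB_pos (hd : 2 ≤ d) (hlam : 0 < lam) (hrho : 0 < rho)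
    (h : P d lam rho (eventB d) ≠ 0) :
    ∃ ε > 0, ∀ rho', 0 < rho' → rho' < rho + ε → 0 < P d lam rho' (eventB d) := by
  have hd0 : (d : ℝ≥0∞) ≠ 0 := by
    simp only [ne_eq, Nat.cast_eq_zero]
    omega
  set y := reachLim d lam rho with hy_def
  have hy : Measurable y := Measurable.iInf fun n => measurable_reach hlam hrho n
  have hy1 : ∀ z, y z ≤ 1 := fun z => (iInf_le _ 0).trans (reach_le_one hlam hrho 0 z)
  have hya : Measurable fun z => anyOf d (y z) := measurable_anyOf hy
  -- `y` decays at a rate `β` strictly between `lam - rho` and `lam`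
  set β := lam - min lam rho / 2 with hβ
  have hmin : 0 < min lam rho := lt_min hlam hrho
  have hβ1 : β < lam := by linarith
  have hβ2 : lam - rho < β := by linarith [min_le_right lam rho]
  obtain ⟨C₀, k, hC₀, hk⟩ := exists_reach_le_exp_of_lt (d := d) hlam hrho hβ1
  have hyβ : ∀ z, 0 < z → y z ≤ ENNReal.ofReal C₀ * ENNReal.ofReal (Real.exp (-(β * z))) :=
    fun z hz => (iInf_le _ k).trans (hk k le_rfl z hz)
  obtain ⟨C₁, hC₁, hexp⟩ := exists_genOp_exp_le hlam hβ2
  -- the defect `N` and its image `g`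
  let N : ℝ → ℝ≥0∞ := fun z => d * y z - anyOf d (y z)
  have hN : Measurable N := (hy.const_mul _).sub hya
  have hNadd : ∀ z, anyOf d (y z) + N z = d * y z := fun z =>
    add_tsub_cancel_of_le (anyOf_le_mul (hy1 z))
  let g : ℝ → ℝ≥0∞ := genOp lam rho N
  have hg : Measurable g := measurable_genOp hN
  let f : ℝ → ℝ≥0∞ := genOp lam rho fun z => d * y z
  have hf : Measurable f := measurable_genOp (hy.const_mul _)
  have hfyg : ∀ u, f u = y u + g u := fun u => by
    rw [show y u = genOp lam rho (fun z => anyOf d (y z)) u from reachLim_eq hlam hrho u]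
    simp only [f, g]
    rw [← genOp_add hya]
    exact congrArg (fun k => genOp lam rho k u) (funext fun z => (hNadd z).symm)
  have hy0 : blueOp rho y 0 ≠ 0 := by
    rw [prob_eventB_eq hlam hrho, blueOp_ne_zero_iff hya] at h
    rw [blueOp_ne_zero_iff hy]
    simpa only [ne_eq, anyOf_eq_zero_iff (show d ≠ 0 by omega)] using h
  have hN0 : blueOp rho N 0 ≠ 0 := by
    rw [blueOp_ne_zero_iff hy] at hy0
    rw [blueOp_ne_zero_iff hN]
    refine fun h0 => hy0 (measure_mono_null (inter_subset_inter_left _ fun z hz => ?_) h0)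
    exact (tsub_pos_of_lt (anyOf_lt_mul hd (hy1 z) hz)).ne'
  obtain ⟨c₁, hc₁, hgc⟩ := exists_le_genOp hlam hN hN0
  have hg0 : ∀ u, 0 < u → g u ≠ 0 := fun u hu h0 => by
    have h1 := hgc u hu
    rw [show genOp lam rho N u = 0 from h0, nonpos_iff_eq_zero, mul_eq_zero] at h1
    rcases h1 with h1 | h1
    · exact (ENNReal.ofReal_pos.2 hc₁).ne' h1
    · exact profile_ne_zero hu h1
  have hdg0 : blueOp rho (fun z => d * g z) 0 ≠ 0 :=
    blueOp_zero_ne_zero_of_pos (hg.const_mul _) one_pos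
      fun z hz _ => mul_ne_zero hd0 (hg0 z hz)
  obtain ⟨c₂, hc₂, hdg⟩ := exists_le_genOp hlam (hg.const_mul (d : ℝ≥0∞)) hdg0
  set C₂ := d * C₀ * C₁ with hC₂_def
  have hdpos : (0 : ℝ) < d := by exact_mod_cast (by omega : 0 < d)
  have hC₂ : 0 < C₂ := by positivity
  have hfle : ∀ u, 0 < u → f u ≤ ENNReal.ofReal C₂ * profile lam u := fun u hu => by
    have h1 : f u ≤ genOp lam rho (fun z => d * ENNReal.ofReal C₀ *
        ENNReal.ofReal (Real.exp (-(β * z)))) u :=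
      genOp_mono (fun z hz => by
        rw [mul_assoc]
        exact mul_le_mul_right (hyβ z hz) _) u
    refine h1.trans ?_
    rw [genOp_const_mul _ (by fun_prop)]
    refine (mul_le_mul_right (hexp u hu) _).trans (le_of_eq ?_)
    rw [hC₂_def, ENNReal.ofReal_mul (by positivity), ENNReal.ofReal_mul (by positivity),
      ENNReal.ofReal_natCast, mul_assoc, mul_assoc, mul_assoc]
  -- the part of `f` beyond `Z` contributes little
  obtain ⟨Z, hZ, hZc⟩ : ∃ Z : ℝ, 0 < Z ∧
      d * C₂ * Real.exp (-((lam - β) * Z)) * C₁ ≤ c₂ / 2 := by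
    have h1 : Filter.Tendsto (fun Z => d * C₂ * C₁ * Real.exp (-((lam - β) * Z))) Filter.atTop
        (nhds 0) := tendsto_exp_neg_mul (by linarith) _
    obtain ⟨Z, h2, h3⟩ := ((h1.eventually_lt_const (by positivity : 0 < c₂ / 2)).and
      (Filter.eventually_gt_atTop 0)).exists
    exact ⟨Z, h3, by linarith⟩
  let f₁ : ℝ → ℝ≥0∞ := (Iic Z).indicator f
  let f₂ : ℝ → ℝ≥0∞ := (Ioi Z).indicator f
  have hf₁ : Measurable f₁ := hf.indicator measurableSet_Iic
  have hf₁₂ : ∀ z, d * f z = d * f₁ z + d * f₂ z := fun z => by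
    rcases le_or_gt z Z with hz | hz
    · simp [f₁, f₂, hz]
    · simp [f₁, f₂, hz]
  have hf₁le : ∀ z, f₁ z ≤ f z := fun z => indicator_le_self _ _ z
  have hf₂le : ∀ z, 0 < z → d * f₂ z ≤ ENNReal.ofReal (d * C₂ * Real.exp (-((lam - β) * Z))) *
      ENNReal.ofReal (Real.exp (-(β * z))) := fun z hz => by
    rcases le_or_gt z Z with hzZ | hzZ
    · simp [f₂, hzZ]
    · simp only [f₂, indicator_of_mem (mem_Ioi.2 hzZ)]
      refine (mul_le_mul_right ((hfle z hz).trans (mul_le_mul_right (profile_le z) _)) _).trans ?_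
      rw [← ENNReal.ofReal_natCast, ← ENNReal.ofReal_mul (by positivity),
        ← ENNReal.ofReal_mul (by positivity), ← ENNReal.ofReal_mul (by positivity)]
      refine ENNReal.ofReal_le_ofReal ?_
      rw [mul_assoc _ (Real.exp _), ← Real.exp_add, ← mul_assoc]
      gcongr
      nlinarith
  have hKf₂ : ∀ u, 0 < u → genOp lam rho (fun z => d * f₂ z) u ≤
      ENNReal.ofReal (c₂ / 2) * profile lam u := fun u hu => by
    refine (genOp_mono hf₂le u).trans ?_
    rw [genOp_const_mul _ (by fun_prop)]
    refine (mul_le_mul_right (hexp u hu) _).trans ?_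
    rw [← mul_assoc, ← ENNReal.ofReal_mul (by positivity)]
    gcongr
  have hKf : ∀ u, 0 < u → f u + ENNReal.ofReal c₂ * profile lam u ≤
      genOp lam rho (fun z => d * f z) u := fun u hu => by
    have h1 : genOp lam rho (fun z => d * f z) u =
        genOp lam rho (fun z => d * y z) u + genOp lam rho (fun z => d * g z) u := by
      rw [← genOp_add (hy.const_mul _)]
      exact congrArg (fun k => genOp lam rho k u) (funext fun z => by rw [hfyg, mul_add])
    rw [h1]
    exact add_le_add le_rfl (hdg u hu)
  have hKf₁ : ∀ u, 0 < u → f u + ENNReal.ofReal (c₂ / 2) * profile lam u ≤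
      genOp lam rho (fun z => d * f₁ z) u := fun u hu => by
    have h1 : genOp lam rho (fun z => d * f z) u =
        genOp lam rho (fun z => d * f₁ z) u + genOp lam rho (fun z => d * f₂ z) u := by
      rw [← genOp_add (hf₁.const_mul _)]
      exact congrArg (fun k => genOp lam rho k u) (funext hf₁₂)
    have h2 := (hKf u hu).trans (h1.le.trans (add_le_add le_rfl (hKf₂ u hu)))
    have h3 : ENNReal.ofReal c₂ = ENNReal.ofReal (c₂ / 2) + ENNReal.ofReal (c₂ / 2) := by
      rw [← ENNReal.ofReal_add (by positivity) (by positivity), add_halves]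
    rw [h3, add_mul, ← add_assoc] at h2
    exact (ENNReal.add_le_add_iff_right
      (ENNReal.mul_ne_top ENNReal.ofReal_ne_top ENNReal.ofReal_ne_top)).1 h2
  refine exists_forall_prob_eventB_pos (d := d) (by omega) hlam hf₁ (M := C₂)
    (c := 1 + c₂ / (2 * C₂)) (Z := Z) hC₂ hZ ?_ ?_ ?_ ?_ ?_
  · intro z
    refine (hf₁le z).trans ?_
    rcases le_or_gt z 0 with hz | hz
    · simp [f, genOp, redOp, Ioo_eq_empty (not_lt.2 hz)]
    · have h1 : profile lam z ≤ 1 := by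
        refine (profile_le z).trans ?_
        rw [← ENNReal.ofReal_one]
        exact ENNReal.ofReal_le_ofReal (Real.exp_le_one_iff.2 (by nlinarith))
      exact (hfle z hz).trans (mul_le_of_le_one_right bot_le h1)
  · have : 0 < c₂ / (2 * C₂) := by positivity
    linarith
  · intro z hz
    simp [f₁, hz]
  · intro u hu
    refine le_trans ?_ (hKf₁ u hu)
    refine (mul_le_mul_right (hf₁le u) _).trans ?_
    rw [ENNReal.ofReal_add zero_le_one (by positivity), ENNReal.ofReal_one, add_mul, one_mul]
    refine add_le_add le_rfl ((mul_le_mul_right (hfle u hu) _).trans (le_of_eq ?_))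
    rw [← mul_assoc, ← ENNReal.ofReal_mul (by positivity)]
    congr 2
    field_simp
  · refine blueOp_zero_ne_zero_of_pos hf₁ hZ fun z hz hzZ => ?_
    simp only [f₁, indicator_of_mem (mem_Iic.2 hzZ.le), hfyg]
    exact fun h0 => hg0 z hz (add_eq_zero.1 h0).2

end openness

/-! ### The critical values -/

lemma mem_Lambda_iff {d : ℕ} (hd : 2 ≤ d) {lam : ℝ} :
    lam ∈ Lambda d ↔ (1 + lam) ^ 2 < 4 * d * lam := by
  have hd2 : (2 : ℝ) ≤ d := by exact_mod_cast hd
  have h1 : (0 : ℝ) ≤ (d : ℝ) ^ 2 - d := by nlinarith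
  have h2 : |lam - (2 * d - 1)| < 2 * √((d : ℝ) ^ 2 - d) ↔
      (lam - (2 * d - 1)) ^ 2 < (2 * √((d : ℝ) ^ 2 - d)) ^ 2 := by
    rw [← sq_abs (lam - _), sq_lt_sq₀ (abs_nonneg _) (by positivity)]
  rw [mul_pow, Real.sq_sqrt h1] at h2
  have h3 : lam ∈ Lambda d ↔ |lam - (2 * d - 1)| < 2 * √((d : ℝ) ^ 2 - d) := by
    rw [Lambda, lamMinus, lamPlus, mem_Ioo, abs_lt]
    constructor <;> rintro ⟨h4, h5⟩ <;> constructor <;> linarith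
  rw [h3, h2]
  constructor <;> intro h <;> nlinarith

lemma isLeast_rhoE {d : ℕ} (hd : 2 ≤ d) {lam : ℝ} (hlam : 0 < lam) :
    IsLeast {rho : ℝ | 0 < rho ∧ P d lam rho (eventA d) = 0} (lam * ((d : ℝ) - 1)) := by
  have hd2 : (2 : ℝ) ≤ d := by exact_mod_cast hd
  refine ⟨⟨mul_pos hlam (by linarith), prob_eventA_critical hd hlam⟩, fun rho hrho => ?_⟩
  by_contra hlt
  exact (prob_eventA_pos hd hlam hrho.1 (not_le.1 hlt)).ne' hrho.2

lemma rhoC_mem {d : ℕ} (hd : 2 ≤ d) {lam : ℝ} (hlam : 0 < lam) (hΛ : lam ∈ Lambda d) :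
    0 < rhoC d lam ∧ P d lam (rhoC d lam) (eventB d) = 0 := by
  obtain ⟨ε, hε, h1⟩ := exists_small_prob_eventB_pos (show d ≠ 0 by omega) hlam
    ((mem_Lambda_iff hd).1 hΛ)
  obtain ⟨r, hr0, -, hr⟩ := exists_prob_eventB_eq_zero hd hlam
  have hne : {rho : ℝ | 0 < rho ∧ P d lam rho (eventB d) = 0}.Nonempty := ⟨r, hr0, hr⟩
  have hpos : 0 < rhoC d lam := by
    refine hε.trans_le (le_csInf hne fun rho hrho => ?_)
    by_contra hlt
    exact (h1 rho hrho.1 (not_le.1 hlt)).ne' hrho.2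
  refine ⟨hpos, ?_⟩
  by_contra hB
  obtain ⟨δ, hδ, h2⟩ := exists_gt_forall_prob_eventB_pos hd hlam hpos hB
  have h3 : rhoC d lam + δ ≤ rhoC d lam := by
    refine le_csInf hne fun rho hrho => ?_
    by_contra hlt
    exact (h2 rho hrho.1 (not_le.1 hlt)).ne' hrho.2
  linarith

end CED

theorem theorem1 (d : ℕ) (hd : 2 ≤ d) (lam : ℝ) (hlam : 0 < lam) :
    (lam ∈ CED.Lambda d →
      0 < CED.rhoC d lam ∧ CED.rhoC d lam < CED.rhoE d lam ∧
      CED.rhoE d lam = lam * ((d : ℝ) - 1) ∧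
      CED.Escape d lam (CED.rhoC d lam) ∧ CED.Extinction d lam (CED.rhoE d lam)) ∧
    (lam ∉ CED.Lambda d →
      {rho : ℝ | 0 < rho ∧ CED.P d lam rho (CED.eventB d) = 0}.Nonempty ∧
      CED.rhoC d lam = 0 ∧ 0 < CED.rhoE d lam ∧
      CED.rhoE d lam = lam * ((d : ℝ) - 1) ∧
      CED.Extinction d lam (CED.rhoE d lam)) := by
  have hE : CED.rhoE d lam = lam * ((d : ℝ) - 1) := (CED.isLeast_rhoE hd hlam).csInf_eq
  have hE0 : 0 < CED.rhoE d lam := hE ▸ (CED.isLeast_rhoE hd hlam).1.1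
  have hext : CED.Extinction d lam (CED.rhoE d lam) := hE ▸ (CED.isLeast_rhoE hd hlam).1.2
  have hbdd : BddBelow {rho : ℝ | 0 < rho ∧ CED.P d lam rho (CED.eventB d) = 0} :=
    ⟨0, fun rho hrho => hrho.1.le⟩
  constructor
  · intro hΛ
    obtain ⟨h0, hB⟩ := CED.rhoC_mem hd hlam hΛ
    obtain ⟨r, hr0, hrlt, hr⟩ := CED.exists_prob_eventB_eq_zero hd hlam
    have hlt : CED.rhoC d lam < lam * ((d : ℝ) - 1) :=
      (csInf_le hbdd ⟨hr0, hr⟩).trans_lt hrlt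
    exact ⟨h0, hE ▸ hlt, hE, ⟨CED.prob_eventA_pos hd hlam h0 hlt, hB⟩, hext⟩
  · intro hΛ
    have hall : ∀ rho, 0 < rho → CED.P d lam rho (CED.eventB d) = 0 := fun rho hrho =>
      CED.prob_eventB_eq_zero_of_mul_le hlam hrho (not_lt.1 fun h =>
        hΛ ((CED.mem_Lambda_iff hd).2 h))
    refine ⟨⟨1, one_pos, hall 1 one_pos⟩, ?_, hE0, hE, hext⟩
    have hset : {rho : ℝ | 0 < rho ∧ CED.P d lam rho (CED.eventB d) = 0} = Ioi 0 := by
      ext rho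
      exact ⟨fun h => h.1, fun h => ⟨h, hall rho h⟩⟩
    rw [CED.rhoC, hset, csInf_Ioi]
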